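/- Let $\mathcal H = L^2(\mathbb R^3;\mathbb C)=L^2(\mathbb R)\otimes L^2(\mathbb R^2)$ be the Hilbert space of three modes $a,b,c$ with coordinates $x_1,x_2,x_3$, and let $\hat a=\frac{1}{\sqrt2}(x_1+\partial_1)$, $\hat a^\dagger=\frac1{\sqrt2}(x_1-\partial_1)$, and likewise $\hat b,\hat b^\dagger$ (with $x_2$) and $\hat c,\hat c^\dagger$ (with $x_3$), act on Schwartz functions. A state is a density operator $\hat\varrho$ on $\mathcal H$ (positive, of trace one); it is $1|23$-separable if $\hat\varrho=\sum_i p_i\,\hat\varrho_{a,i}\otimes\hat\varrho_{bc,i}$ for a finite or countable probability distribution $(p_i)$, density operators $\hat\varrho_{a,i}$ on $L^2(\mathbb R)$ and $\hat\varrho_{bc,i}$ on $L^2(\mathbb R^2)$. For an integer $m\ge 0$ put $$\mathcal A^{(m)}_{1|23}(\hat\varrho)=\frac1{m!}\big\langle(\hat a^\dagger+\hat b+\hat c)^m(\hat a+\hat b^\dagger+\hat c^\dagger)^m\big\rangle_{\hat\varrho}=\frac1{m!}\operatorname{Tr}\big((\hat a+\hat b^\dagger+\hat c^\dagger)^m\,\hat\varrho\,(\hat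 a^\dagger+\hat b+\hat c)^m\big)\in[0,\infty],$$ where the trace of the positive form $f\mapsto\langle K f,\hat\varrho K f\rangle$, $K=(\hat a^\dagger+\hat b+\hat c)^m$, is the supremum of $\sum_i\langle Kf_i,\hat\varrho Kf_i\rangle$ over finite orthonormal systems $(f_i)$ of Schwartz functions (the value $\infty$ means that the moment does not exist). Then: 1. $\mathcal A^{(m)}_{1|23}(\hat\varrho)\ge 2^m$ for every $m$ and every $1|23$-separable state $\hat\varrho$; 2. $\mathcal A^{(m)}_{1|23}(\hat\varrho)\ge 1$ for every $m$ and every state $\hat\varrho$; 3. the wave function $\psi(\vec x)=\pi^{-3/4}\exp\left(-\tfrac12\vec x^{\mathrm T}A\vec x\right)$ with $A=\begin{pmatrix}3&2&2\\2&2&1\\2&1&2\end{pmatrix}$ is a unit vector, and the pure Gaussian state $|\psi\rangle\langle\psi|$ satisfies $\mathcal A^{(m)}_{1|23}(|\psi\rangle\langle\psi|)=1$ for all $m\ge1$; hence it minimizes all the quantities $\mathcal A^{(m)}_{1|23}$, $m\ge1$, over all states simultaneously. -/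

import Mathlib

open MeasureTheory
open scoped ENNReal SchwartzMap InnerProductSpace LineDeriv

noncomputable section

namespace ThreeMode

/-- Configuration space of three modes; the first factor belongs to mode `a`, the second factor
`ℝ × ℝ` to the modes `b` and `c`. -/
abbrev Config : Type := ℝ × ℝ × ℝ

instance isAddHaarMeasure_volume_plane : (volume : Measure (ℝ × ℝ)).IsAddHaarMeasure :=
  inferInstanceAs ((volume : Measure ℝ).prod (volume : Measure ℝ)).IsAddHaarMeasure

instance isAddHaarMeasure_volume_config : (volume : Measure Config).IsAddHaarMeasure :=
  inferInstanceAs ((volume : Measure ℝ).prod (volume : Measure (ℝ × ℝ))).IsAddHaarMeasure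

/-- The Hilbert space `L²(X)` of square-integrable wave functions. -/
abbrev L2 (X : Type) [MeasureSpace X] : Type := Lp ℂ 2 (volume : Measure X)

/-! ### Density operators -/

/-- A density operator: a positive bounded operator of trace one. -/
structure IsDensityOperator {H : Type*} [NormedAddCommGroup H] [InnerProductSpace ℂ H]
    [CompleteSpace H] (ρ : H →L[ℂ] H) : Prop where
  isPositive : ρ.IsPositive
  trace_eq_one : ∀ (ι : Type) (e : HilbertBasis ι ℂ H),
    HasSum (fun i => ⟪e i, ρ (e i)⟫_ℂ) 1

/-- The operator `|ψ⟩⟨ψ|`; it is a density operator when `ψ` is a unit vector. -/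
def pureState {H : Type*} [NormedAddCommGroup H] [InnerProductSpace ℂ H] (ψ : H) : H →L[ℂ] H :=
  InnerProductSpace.rankOne ℂ ψ ψ

/-! ### Tensor products and `1|23` separability -/

theorem memLp_tensor {X Y : Type} [MeasureSpace X] [MeasureSpace Y]
    [SFinite (volume : Measure X)] [SFinite (volume : Measure Y)] (f : L2 X) (g : L2 Y) :
    MemLp (fun p : X × Y => f p.1 * g p.2) 2 (volume : Measure (X × Y)) := by
  have hf := Lp.memLp f
  have hg := Lp.memLp g
  have hm : AEStronglyMeasurable (fun p : X × Y => f p.1 * g p.2)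
      (volume : Measure (X × Y)) :=
    (hf.1.comp_quasiMeasurePreserving Measure.quasiMeasurePreserving_fst).mul
      (hg.1.comp_quasiMeasurePreserving Measure.quasiMeasurePreserving_snd)
  rw [memLp_two_iff_integrable_sq_norm hm]
  have h := ((memLp_two_iff_integrable_sq_norm hf.1).1 hf).mul_prod
    ((memLp_two_iff_integrable_sq_norm hg.1).1 hg)
  refine h.congr (Filter.Eventually.of_forall fun p => ?_)
  simp [mul_pow]

/-- The tensor product `f ⊗ g` as the wave function `(x, y) ↦ f x * g y`, under the
identification of `L²(X) ⊗ L²(Y)` with `L²(X × Y)`. -/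
def tensor {X Y : Type} [MeasureSpace X] [MeasureSpace Y]
    [SFinite (volume : Measure X)] [SFinite (volume : Measure Y)] (f : L2 X) (g : L2 Y) :
    L2 (X × Y) :=
  (memLp_tensor f g).toLp _

/-- `σ = S ⊗ T`, the bounded operator with `(S ⊗ T)(f ⊗ g) = S f ⊗ T g`. It is determined by
this property, since the product vectors span a dense subspace. -/
def IsTensorProduct {X Y : Type} [MeasureSpace X] [MeasureSpace Y]
    [SFinite (volume : Measure X)] [SFinite (volume : Measure Y)]
    (σ : L2 (X × Y) →L[ℂ] L2 (X × Y)) (S : L2 X →L[ℂ] L2 X) (T : L2 Y →L[ℂ] L2 Y) : Prop :=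
  ∀ (f : L2 X) (g : L2 Y), σ (tensor f g) = tensor (S f) (T g)

/-- `ρ = ∑ᵢ pᵢ ρₐ,ᵢ ⊗ ρ_bc,ᵢ` with a probability distribution `p` and density operators `ρₐ,ᵢ` of
mode `a` and `ρ_bc,ᵢ` of the modes `b`, `c` (finite mixtures are those with `pᵢ = 0` for almost
all `i`). -/
def IsSeparable1_23 (ρ : L2 Config →L[ℂ] L2 Config) : Prop :=
  ∃ (p : ℕ → ℝ) (ρa : ℕ → L2 ℝ →L[ℂ] L2 ℝ) (ρbc : ℕ → L2 (ℝ × ℝ) →L[ℂ] L2 (ℝ × ℝ))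
    (σ : ℕ → L2 Config →L[ℂ] L2 Config),
    (∀ i, 0 ≤ p i) ∧ HasSum p 1 ∧
    (∀ i, IsDensityOperator (ρa i)) ∧ (∀ i, IsDensityOperator (ρbc i)) ∧
    (∀ i, IsTensorProduct (σ i) (ρa i) (ρbc i)) ∧
    HasSum (fun i => (p i : ℂ) • σ i) ρ

/-! ### Mode operators on Schwartz functions -/

/-- The coordinate functions of the three modes `a = 0`, `b = 1`, `c = 2`. -/
def coord : Fin 3 → Config →L[ℝ] ℝ :=
  ![ContinuousLinearMap.fst ℝ ℝ (ℝ × ℝ),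
    (ContinuousLinearMap.fst ℝ ℝ ℝ).comp (ContinuousLinearMap.snd ℝ ℝ (ℝ × ℝ)),
    (ContinuousLinearMap.snd ℝ ℝ ℝ).comp (ContinuousLinearMap.snd ℝ ℝ (ℝ × ℝ))]

/-- The coordinate directions of the three modes. -/
def dir : Fin 3 → Config := ![(1, 0, 0), (0, 1, 0), (0, 0, 1)]

/-- The position operator: multiplication by the `j`-th coordinate. -/
def position (j : Fin 3) : 𝓢(Config, ℂ) →ₗ[ℂ] 𝓢(Config, ℂ) :=
  (SchwartzMap.smulLeftCLM ℂ (fun x : Config => ((coord j x : ℝ) : ℂ))).toLinearMap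

/-- The partial derivative in the `j`-th coordinate. -/
def partialDeriv (j : Fin 3) : 𝓢(Config, ℂ) →ₗ[ℂ] 𝓢(Config, ℂ) :=
  (LineDeriv.lineDerivOpCLM ℂ 𝓢(Config, ℂ) (dir j)).toLinearMap

/-- The annihilation operator `(x + ∂) / √2` of mode `j`. -/
def annihilation (j : Fin 3) : Module.End ℂ 𝓢(Config, ℂ) :=
  ((1 / √2 : ℝ) : ℂ) • (position j + partialDeriv j)

/-- The creation operator `(x - ∂) / √2` of mode `j`. -/
def creation (j : Fin 3) : Module.End ℂ 𝓢(Config, ℂ) :=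
  ((1 / √2 : ℝ) : ℂ) • (position j - partialDeriv j)

/-- `a† + b + c`. -/
def W : Module.End ℂ 𝓢(Config, ℂ) := creation 0 + annihilation 1 + annihilation 2

/-- `a + b† + c†`, the formal adjoint of `W`. -/
def Wdag : Module.End ℂ 𝓢(Config, ℂ) := annihilation 0 + creation 1 + creation 2

/-! ### Expectation values -/

/-- A Schwartz function as a vector of `L²`. -/
def toL2 (f : 𝓢(Config, ℂ)) : L2 Config := f.toLp 2

/-- The expectation value `⟨K K†⟩ = Tr (K† ρ K) ∈ [0, ∞]` of the (generally unbounded)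
nonnegative observable `K K†` in the state `ρ`. The trace of the positive form
`f ↦ ⟨K f, ρ K f⟩`, which is defined on the dense space of Schwartz functions, is the supremum of
its traces over finite orthonormal systems of Schwartz functions. It is finite exactly when the
moment exists; for `ρ = ∑ᵢ pᵢ |ψᵢ⟩⟨ψᵢ|` it is `∑ᵢ pᵢ ‖K† ψᵢ‖²`, where `‖K† ψ‖ = ∞` if `K† ψ`, taken
in the sense of distributions, is not in `L²`. -/
def expectMulAdjoint (K : Module.End ℂ 𝓢(Config, ℂ)) (ρ : L2 Config →L[ℂ] L2 Config) : ℝ≥0∞ :=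
  ⨆ (n : ℕ) (f : Fin n → 𝓢(Config, ℂ)) (_ : Orthonormal ℂ (fun i => toL2 (f i))),
    ∑ i, ENNReal.ofReal (RCLike.re ⟪toL2 (K (f i)), ρ (toL2 (K (f i)))⟫_ℂ)

/-- `A^(m)_{1|23} = (1 / m!) ⟨(a† + b + c)^m (a + b† + c†)^m⟩`. -/
def A1_23 (m : ℕ) (ρ : L2 Config →L[ℂ] L2 Config) : ℝ≥0∞ :=
  expectMulAdjoint (W ^ m) ρ / (m.factorial : ℝ≥0∞)

/-! ### Agreement with the formal expectation value on Schwartz wave functions -/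

theorem inner_toL2 (f g : 𝓢(Config, ℂ)) :
    ⟪toL2 f, toL2 g⟫_ℂ = ∫ x, (starRingEnd ℂ) (f x) * g x := by
  unfold toL2
  refine (SchwartzMap.inner_toL2_toL2_eq f g (volume : Measure Config)).trans ?_
  simp [RCLike.inner_apply, mul_comm]

theorem toL2_add (f g : 𝓢(Config, ℂ)) : toL2 (f + g) = toL2 f + toL2 g :=
  map_add (SchwartzMap.toLpCLM ℂ ℂ 2 (volume : Measure Config)) f g

theorem toL2_sub (f g : 𝓢(Config, ℂ)) : toL2 (f - g) = toL2 f - toL2 g :=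
  map_sub (SchwartzMap.toLpCLM ℂ ℂ 2 (volume : Measure Config)) f g

theorem toL2_smul (c : ℂ) (f : 𝓢(Config, ℂ)) : toL2 (c • f) = c • toL2 f :=
  map_smul (SchwartzMap.toLpCLM ℂ ℂ 2 (volume : Measure Config)) c f

theorem coord_temperate (j : Fin 3) :
    Function.HasTemperateGrowth (fun x : Config => ((coord j x : ℝ) : ℂ)) := by
  have := (Complex.ofRealCLM.comp (coord j)).hasTemperateGrowth
  exact this

theorem position_apply (j : Fin 3) (f : 𝓢(Config, ℂ)) (x : Config) :
    position j f x = (coord j x : ℂ) * f x := by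
  simp [position, SchwartzMap.smulLeftCLM_apply_apply (coord_temperate j)]

theorem inner_position (j : Fin 3) (f g : 𝓢(Config, ℂ)) :
    ⟪toL2 (position j f), toL2 g⟫_ℂ = ⟪toL2 f, toL2 (position j g)⟫_ℂ := by
  rw [inner_toL2, inner_toL2]
  congr 1; ext x
  rw [position_apply, position_apply]
  simp; ring

theorem inner_deriv (j : Fin 3) (f g : 𝓢(Config, ℂ)) :
    ⟪toL2 (partialDeriv j f), toL2 g⟫_ℂ = - ⟪toL2 f, toL2 (partialDeriv j g)⟫_ℂ := by
  rw [inner_toL2, inner_toL2]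
  have := SchwartzMap.integral_bilinear_lineDerivOp_right_eq_neg_left (μ := volume) f g
    ((ContinuousLinearMap.mul ℝ ℂ).comp (Complex.conjCLE : ℂ →L[ℝ] ℂ)) (dir j)
  simp at this
  simp [partialDeriv, this]

theorem inner_ann (j : Fin 3) (f g : 𝓢(Config, ℂ)) :
    ⟪toL2 (annihilation j f), toL2 g⟫_ℂ = ⟪toL2 f, toL2 (creation j g)⟫_ℂ := by
  simp only [annihilation, creation, LinearMap.smul_apply, LinearMap.add_apply,
    LinearMap.sub_apply, toL2_smul, toL2_add, toL2_sub, inner_smul_left, inner_smul_right,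
    inner_add_left, inner_sub_right, inner_position, inner_deriv, Complex.conj_ofReal]
  ring

/-- `a + b† + c†` is the formal adjoint of `a† + b + c`. -/
theorem inner_W (f g : 𝓢(Config, ℂ)) :
    ⟪toL2 (W f), toL2 g⟫_ℂ = ⟪toL2 f, toL2 (Wdag g)⟫_ℂ := by
  have h : ⟪toL2 (creation 0 f), toL2 g⟫_ℂ = ⟪toL2 f, toL2 (annihilation 0 g)⟫_ℂ := by
    rw [← inner_conj_symm, ← inner_ann, inner_conj_symm]
  simp only [W, Wdag, LinearMap.add_apply, toL2_add, inner_add_left, inner_add_right, inner_ann, h]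

theorem inner_W_pow (m : ℕ) (f g : 𝓢(Config, ℂ)) :
    ⟪toL2 ((W ^ m) f), toL2 g⟫_ℂ = ⟪toL2 f, toL2 ((Wdag ^ m) g)⟫_ℂ := by
  induction m generalizing f g with
  | zero => simp
  | succ m ih => rw [pow_succ, pow_succ', Module.End.mul_apply, Module.End.mul_apply, ih, inner_W]

/-- For a Schwartz wave function `ψ` the value of `⟨(a† + b + c)^m (a + b† + c†)^m⟩` is literally
`⟨ψ, (a† + b + c)^m (a + b† + c†)^m ψ⟩`. -/
theorem expect_pure (m : ℕ) (ψ : 𝓢(Config, ℂ)) :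
    expectMulAdjoint (W ^ m) (pureState (toL2 ψ)) =
      ENNReal.ofReal (RCLike.re ⟪toL2 ψ, toL2 ((W ^ m * Wdag ^ m) ψ)⟫_ℂ) := by
  set u := (Wdag ^ m) ψ with hu
  have hR : RCLike.re ⟪toL2 ψ, toL2 ((W ^ m * Wdag ^ m) ψ)⟫_ℂ = ‖toL2 u‖ ^ 2 := by
    rw [Module.End.mul_apply, ← inner_conj_symm, inner_W_pow, inner_self_eq_norm_sq_to_K]
    norm_cast
  have hT : ∀ f : 𝓢(Config, ℂ), RCLike.re ⟪toL2 ((W ^ m) f),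
      pureState (toL2 ψ) (toL2 ((W ^ m) f))⟫_ℂ = ‖⟪toL2 f, toL2 u⟫_ℂ‖ ^ 2 := by
    intro f
    rw [pureState, InnerProductSpace.rankOne_apply, inner_smul_right, ← inner_W_pow,
      inner_mul_symm_re_eq_norm]
    rw [norm_mul, norm_inner_symm]; ring
  rw [hR]
  apply le_antisymm
  · refine iSup_le fun n => iSup_le fun f => iSup_le fun hf => ?_
    simp only [hT]
    rw [← ENNReal.ofReal_sum_of_nonneg (fun _ _ => by positivity)]
    exact ENNReal.ofReal_le_ofReal (hf.sum_inner_products_le (x := toL2 u) (s := Finset.univ))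
  · by_cases h0 : toL2 u = 0
    · simp [h0]
    have hn : ‖toL2 u‖ ≠ 0 := by simpa using h0
    let g : Fin 1 → 𝓢(Config, ℂ) := fun _ => ((‖toL2 u‖⁻¹ : ℝ) : ℂ) • u
    have hg : Orthonormal ℂ (fun i => toL2 (g i)) := by
      constructor
      · intro i
        simp [g, toL2_smul, norm_smul, hn]
      · intro i j hij; exact absurd (Subsingleton.elim i j) hij
    refine le_iSup_of_le 1 (le_iSup_of_le g (le_iSup_of_le hg ?_))
    simp only [hT]
    rw [Fin.sum_univ_one]
    apply ENNReal.ofReal_le_ofReal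
    simp [g, toL2_smul, inner_smul_left]
    rw [pow_two ‖toL2 u‖, inv_mul_cancel_left₀ hn, pow_two]

/-! ### The Gaussian state -/

/-- The matrix of the Gaussian state. -/
def gaussMatrix : Matrix (Fin 3) (Fin 3) ℝ := !![3, 2, 2; 2, 2, 1; 2, 1, 2]

/-- The wave function `π^(-3/4) exp (-(1/2) xᵀ A x)`. -/
def gaussWave (p : Config) : ℂ :=
  let x : Fin 3 → ℝ := ![p.1, p.2.1, p.2.2]
  ((Real.pi ^ (-(3 / 4) : ℝ) * Real.exp (-(1 / 2) * (x ⬝ᵥ (gaussMatrix.mulVec x))) : ℝ) : ℂ)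

end ThreeMode

end

noncomputable section

namespace ThreeMode

/-! ### Normal ordering -/

section NormalOrdering

variable {R : Type*} [Ring R] [Algebra ℂ R] {D E : R} {κ : ℂ}

/-! Write W = a† + b + c and W† = a + b† + c†. Modes b and c each contribute +1 to [W, W†] and mode
a contributes -1, so [W, W†] = 1. For a regular vector ψ, normal ordering W^m W†^m turns ‖W†^m ψ‖²
into a sum of nonnegative terms ‖W^(m-j) ψ‖² whose last one is m! ‖ψ‖²; this is
`norm_pow_ge_of_commutator` and gives the bound 1. The Gaussian ψ satisfies W ψ = 0, so only that
last term survives and the bound is attained (`W_gaussS`, `W_pow_Wdag_pow_gaussS`).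

On a product state, mode a may be transposed: its Gram matrix is again one of vectors, with the
first factor conjugated. Transposition exchanges the powers of a in the two slots of an inner
product. Only the operators of b and c then need reordering, and [b + c, b† + c†] = 2 replaces the
commutator 1. The outcome is again a sum of squares, with last term m! 2^m
(`norm_add_pow_ge_of_transpose`). Mixtures follow by linearity.

A general state lies in no operator domain. Its square root R turns it into the vector-valued family
Ψ_i = R e_i over the number states e_i, on which W† acts as the formal operator `ladder`; the trace
dominates Σ_i ‖(ladder^m Ψ)_i‖². Damping by t^N, with N the total number of quanta and t < 1, makes
the family rapidly decreasing, and conjugation by t^N merely rescales the ladder operators. The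
algebraic bounds hold for each t near 1, and t → 1 removes the damping (`tsum_ladder_ge_of_damped`).
That Σ_i ‖Ψ_i‖² is the trace 1 requires completeness of the number states
(`eq_zero_of_inner_numberState`). -/

theorem mul_pow_of_commutator (h : D * E = E * D + algebraMap ℂ R κ) (n : ℕ) :
    D * E ^ n = E ^ n * D + ((n : ℂ) * κ) • E ^ (n - 1) := by
  induction n with
  | zero => simp
  | succ n ih =>
    have hc : E ^ n * algebraMap ℂ R κ = κ • E ^ n := by
      rw [Algebra.smul_def, Algebra.commutes]
    -- The truncated exponent `n - 1` is wrong only for n = 0, where the coefficient n vanishes.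
    have hn : ((n : ℂ) * κ) • (E ^ (n - 1) * E) = ((n : ℂ) * κ) • E ^ n := by
      rcases n with _ | n
      · simp
      · simp [pow_succ]
    rw [pow_succ, ← mul_assoc, ih, add_mul, mul_assoc, h, mul_add, hc, smul_mul_assoc, hn,
      ← mul_assoc, add_assoc, ← add_smul]
    congr 2
    push_cast; ring

/-- The normally ordered form of `D ^ p * E ^ q` when `[D, E] = κ` is a scalar. -/
theorem pow_mul_pow_of_commutator (h : D * E = E * D + algebraMap ℂ R κ) (p q : ℕ) :
    D ^ p * E ^ q = ∑ j ∈ Finset.range (p + 1),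
      (((p.choose j * q.descFactorial j : ℕ) : ℂ) * κ ^ j) • (E ^ (q - j) * D ^ (p - j)) := by
  induction p with
  | zero => simp
  | succ p ih =>
    rw [pow_succ', mul_assoc, ih, Finset.mul_sum]
    have h1 : ∀ j ∈ Finset.range (p + 1),
        D * ((((p.choose j * q.descFactorial j : ℕ) : ℂ) * κ ^ j) • (E ^ (q - j) * D ^ (p - j))) =
        (((p.choose j * q.descFactorial j : ℕ) : ℂ) * κ ^ j) • (E ^ (q - j) * D ^ (p + 1 - j)) +
        (((p.choose j * q.descFactorial (j + 1) : ℕ) : ℂ) * κ ^ (j + 1)) •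
          (E ^ (q - (j + 1)) * D ^ (p - j)) := by
      intro j hj
      have hj' : p + 1 - j = p - j + 1 := by have := Finset.mem_range.1 hj; omega
      rw [mul_smul_comm, ← mul_assoc, mul_pow_of_commutator h, add_mul, mul_assoc, ← pow_succ',
        ← hj', smul_mul_assoc, smul_add, smul_smul, Nat.descFactorial_succ, Nat.sub_sub]
      congr 2
      push_cast; ring
    -- A term j = p + 1 can be added for free because its binomial coefficient is zero; splitting
    -- off j = 0 instead aligns the sum for Pascal's rule.
    have h2 : ∑ j ∈ Finset.range (p + 1),
        (((p.choose j * q.descFactorial j : ℕ) : ℂ) * κ ^ j) • (E ^ (q - j) * D ^ (p + 1 - j)) =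
        ∑ j ∈ Finset.range (p + 1), (((p.choose (j + 1) * q.descFactorial (j + 1) : ℕ) : ℂ) *
          κ ^ (j + 1)) • (E ^ (q - (j + 1)) * D ^ (p - j)) + E ^ q * D ^ (p + 1) := by
      have := Finset.sum_range_succ (fun j => (((p.choose j * q.descFactorial j : ℕ) : ℂ) * κ ^ j) •
        (E ^ (q - j) * D ^ (p + 1 - j))) (p + 1)
      rw [Finset.sum_range_succ'] at this
      simpa using this.symm
    rw [Finset.sum_congr rfl h1, Finset.sum_add_distrib, h2, Finset.sum_range_succ' _ (p + 1),
      add_right_comm, ← Finset.sum_add_distrib]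
    congr 1
    · refine Finset.sum_congr rfl fun j _ => ?_
      rw [← add_smul, Nat.choose_succ_succ', Nat.add_sub_add_right]
      congr 1
      push_cast; ring
    · simp

end NormalOrdering

/-! ### Lower bounds from commutation relations -/

section LowerBounds

variable {V H : Type*} [AddCommGroup V] [Module ℂ V] [NormedAddCommGroup H]
  [InnerProductSpace ℂ H] (J : V →ₗ[ℂ] H)

theorem inner_pow_of_adjoint {L L' : Module.End ℂ V}
    (hL : ∀ v w, ⟪J (L v), J w⟫_ℂ = ⟪J v, J (L' w)⟫_ℂ) (m : ℕ) (v w : V) :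
    ⟪J ((L ^ m) v), J w⟫_ℂ = ⟪J v, J ((L' ^ m) w)⟫_ℂ := by
  induction m generalizing v w with
  | zero => simp
  | succ m ih => rw [pow_succ, pow_succ', Module.End.mul_apply, Module.End.mul_apply, ih, hL]

theorem inner_adjoint_symm {L L' : Module.End ℂ V}
    (hL : ∀ v w, ⟪J (L v), J w⟫_ℂ = ⟪J v, J (L' w)⟫_ℂ) (v w : V) :
    ⟪J (L' v), J w⟫_ℂ = ⟪J v, J (L w)⟫_ℂ := by
  rw [← inner_conj_symm, ← hL, inner_conj_symm]

/-- Moving L^m across the inner product produces L'^m L^m. Normal ordering and moving the powers of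
L back make every term a squared norm with coefficient nonnegative for κ ≥ 0. Keeping only j = m
gives the bound. -/
theorem norm_pow_ge_of_commutator {L L' : Module.End ℂ V}
    (hL : ∀ v w, ⟪J (L v), J w⟫_ℂ = ⟪J v, J (L' w)⟫_ℂ) {κ : ℝ} (hκ : 0 ≤ κ)
    (h : L' * L = L * L' + algebraMap ℂ _ (κ : ℂ)) (m : ℕ) (v : V) :
    m.factorial * κ ^ m * ‖J v‖ ^ 2 ≤ ‖J ((L ^ m) v)‖ ^ 2 := by
  have key : ‖J ((L ^ m) v)‖ ^ 2 = ∑ j ∈ Finset.range (m + 1),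
      ((m.choose j * m.descFactorial j : ℕ) : ℝ) * κ ^ j * ‖J ((L' ^ (m - j)) v)‖ ^ 2 := by
    have : ((‖J ((L ^ m) v)‖ ^ 2 : ℝ) : ℂ) = ((∑ j ∈ Finset.range (m + 1),
      ((m.choose j * m.descFactorial j : ℕ) : ℝ) * κ ^ j *
          ‖J ((L' ^ (m - j)) v)‖ ^ 2 : ℝ) : ℂ) := by
      have h0 := inner_self_eq_norm_sq_to_K (𝕜 := ℂ) (J ((L ^ m) v))
      push_cast at h0 ⊢
      rw [← Complex.coe_algebraMap] at *
      rw [← h0, inner_pow_of_adjoint J hL, ← Module.End.mul_apply, pow_mul_pow_of_commutator h]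
      simp only [LinearMap.sum_apply, map_sum, inner_sum, LinearMap.smul_apply, map_smul,
        inner_smul_right, Module.End.mul_apply]
      refine Finset.sum_congr rfl fun j _ => ?_
      have h1 := inner_self_eq_norm_sq_to_K (𝕜 := ℂ) (J ((L' ^ (m - j)) v))
      rw [← inner_pow_of_adjoint J (inner_adjoint_symm J hL), h1]
      push_cast
      rfl
    exact_mod_cast this
  rw [key, Finset.sum_range_succ]
  refine le_add_of_nonneg_of_le (Finset.sum_nonneg fun j _ => by positivity) ?_
  simp [Nat.descFactorial_self]

/-- A lower bound for product-like vectors: `v'` is a partial transpose of `v` with respect to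
the mode on which `A` acts. -/
theorem norm_add_pow_ge_of_transpose {A D D' : Module.End ℂ V}
    (hD : ∀ v w, ⟪J (D v), J w⟫_ℂ = ⟪J v, J (D' w)⟫_ℂ) {κ : ℝ} (hκ : 0 ≤ κ)
    (h : D * D' = D' * D + algebraMap ℂ _ (κ : ℂ)) (hAD : Commute A D) (hAD' : Commute A D')
    {v v' : V} (hv : ∀ p q x y : ℕ, ⟪J ((A ^ p * D ^ x) v), J ((A ^ q * D ^ y) v)⟫_ℂ =
      ⟪J ((A ^ q * D ^ x) v'), J ((A ^ p * D ^ y) v')⟫_ℂ) (m : ℕ) :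
    m.factorial * κ ^ m * ‖J v'‖ ^ 2 ≤ ‖J (((A + D') ^ m) v)‖ ^ 2 := by
  -- Since C(m,p) C(p,j) = C(m,j) C(m-j,p-j), the vector `s j` is C(m,j) times the image of (A +
  -- D)^(m-j) v'.
  set u : ℕ → ℕ → H := fun j p => J ((A ^ (m - p) * D ^ (p - j)) v') with hu
  set s : ℕ → H := fun j => ∑ p ∈ Finset.range (m + 1),
    ((m.choose p * p.choose j : ℕ) : ℂ) • u j p with hs
  -- After normal ordering D^p D'^q, the factor D'^(q-j) returns to the left slot as D^(q-j). The
  -- transposition `hv` then exchanges the powers of A, so that the left vector depends on q alone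
  -- and the right one on p alone. The range of j is made independent of p, as C(p,j) = 0 for j > p.
  have hterm : ∀ p ∈ Finset.range (m + 1), ∀ q,
      ⟪J ((D' ^ p * A ^ (m - p)) v), J ((D' ^ q * A ^ (m - q)) v)⟫_ℂ =
      ∑ j ∈ Finset.range (m + 1),
        (((p.choose j * q.descFactorial j : ℕ) : ℂ) * (κ : ℂ) ^ j) * ⟪u j q, u j p⟫_ℂ := by
    intro p hp q
    have hsub : Finset.range (p + 1) ⊆ Finset.range (m + 1) := by
      have := Finset.mem_range.1 hp
      exact Finset.range_subset_range.2 (by omega)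
    rw [← Finset.sum_subset hsub]
    · rw [Module.End.mul_apply, inner_pow_of_adjoint J (inner_adjoint_symm J hD),
        ← Module.End.mul_apply, ← mul_assoc, pow_mul_pow_of_commutator h, Finset.sum_mul]
      simp only [LinearMap.sum_apply, map_sum, inner_sum, smul_mul_assoc, LinearMap.smul_apply,
        map_smul, inner_smul_right]
      refine Finset.sum_congr rfl fun j _ => ?_
      rw [mul_assoc (D' ^ (q - j)), Module.End.mul_apply, ← inner_pow_of_adjoint J hD,
        ← Module.End.mul_apply, ← (hAD.pow_pow (m - p) (q - j)).eq,
        ← (hAD.pow_pow (m - q) (p - j)).eq, hv]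
    · intro j _ hj
      have : p < j := by simpa using hj
      simp [Nat.choose_eq_zero_of_lt this]
  -- The descending factorial of q is j! C(q,j), which makes the coefficients symmetric in p and q
  -- up to j! κ^j; the double sum over p, q is then a squared norm.
  have key : ‖J (((A + D') ^ m) v)‖ ^ 2 =
      ∑ j ∈ Finset.range (m + 1), j.factorial * κ ^ j * ‖s j‖ ^ 2 := by
    have : ((‖J (((A + D') ^ m) v)‖ ^ 2 : ℝ) : ℂ) =
        ((∑ j ∈ Finset.range (m + 1), j.factorial * κ ^ j * ‖s j‖ ^ 2 : ℝ) : ℂ) := by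
      have h0 := inner_self_eq_norm_sq_to_K (𝕜 := ℂ) (J (((A + D') ^ m) v))
      have hexp : J (((A + D') ^ m) v) = ∑ p ∈ Finset.range (m + 1),
          ((m.choose p : ℕ) : ℂ) • J ((D' ^ p * A ^ (m - p)) v) := by
        rw [add_comm, hAD'.symm.add_pow, LinearMap.sum_apply, map_sum]
        refine Finset.sum_congr rfl fun p _ => ?_
        rw [(Nat.cast_commute _ _).symm.eq, Module.End.mul_apply, ← map_smul]
        congr 1
        simp [Nat.cast_smul_eq_nsmul]
      have hsj : ∀ j, ((‖s j‖ ^ 2 : ℝ) : ℂ) = ∑ q ∈ Finset.range (m + 1),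
          ∑ p ∈ Finset.range (m + 1), ((m.choose q * q.choose j : ℕ) : ℂ) *
            (((m.choose p * p.choose j : ℕ) : ℂ) * ⟪u j q, u j p⟫_ℂ) := by
        intro j
        have h1 := inner_self_eq_norm_sq_to_K (𝕜 := ℂ) (s j)
        push_cast at h1 ⊢
        rw [← Complex.coe_algebraMap] at *
        rw [← h1, hs]
        simp only [sum_inner, inner_sum, inner_smul_left, inner_smul_right, map_natCast,
          Finset.mul_sum]
        rw [Finset.sum_comm]
        push_cast
        refine Finset.sum_congr rfl fun q _ => Finset.sum_congr rfl fun p _ => ?_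
        ring
      have h2 : ((‖J (((A + D') ^ m) v)‖ ^ 2 : ℝ) : ℂ) = ∑ q ∈ Finset.range (m + 1),
          ∑ p ∈ Finset.range (m + 1), ∑ j ∈ Finset.range (m + 1),
          (m.choose p : ℂ) * ((m.choose q : ℂ) *
            ((((p.choose j * q.descFactorial j : ℕ) : ℂ) * (κ : ℂ) ^ j) * ⟪u j q, u j p⟫_ℂ)) := by
        push_cast
        rw [← Complex.coe_algebraMap] at *
        rw [← h0, hexp]
        simp only [sum_inner, inner_sum, inner_smul_left, inner_smul_right, map_natCast]
        refine Finset.sum_congr rfl fun q _ => ?_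
        rw [Finset.mul_sum]
        refine Finset.sum_congr rfl fun p hp => ?_
        rw [hterm p hp q, Finset.mul_sum, Finset.mul_sum]
        refine Finset.sum_congr rfl fun j _ => ?_
        simp only [Complex.coe_algebraMap]
        push_cast; ring
      rw [h2, Complex.ofReal_sum]
      have h3 : ∀ j, ((j.factorial * κ ^ j * ‖s j‖ ^ 2 : ℝ) : ℂ) = ∑ q ∈ Finset.range (m + 1),
          ∑ p ∈ Finset.range (m + 1), (m.choose p : ℂ) * ((m.choose q : ℂ) *
            ((((p.choose j * q.descFactorial j : ℕ) : ℂ) * (κ : ℂ) ^ j) * ⟪u j q, u j p⟫_ℂ)) := by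
        intro j
        rw [Complex.ofReal_mul, hsj, Finset.mul_sum]
        refine Finset.sum_congr rfl fun q _ => ?_
        rw [Finset.mul_sum]
        refine Finset.sum_congr rfl fun p _ => ?_
        rw [Nat.descFactorial_eq_factorial_mul_choose]
        push_cast; ring
      simp only [h3]
      rw [Finset.sum_comm' (t' := Finset.range (m + 1)) (s' := fun _ => Finset.range (m + 1))
        (by intros; tauto)]
      rw [Finset.sum_comm]
      refine (Finset.sum_congr rfl fun q _ => Finset.sum_comm).trans ?_
      exact Finset.sum_comm
    exact_mod_cast this
  have hm : s m = J v' := by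
    rw [hs]
    simp only
    rw [Finset.sum_range_succ, Finset.sum_eq_zero]
    · simp [hu]
    · intro p hp
      simp [Nat.choose_eq_zero_of_lt (Finset.mem_range.1 hp)]
  rw [key, Finset.sum_range_succ, hm]
  exact le_add_of_nonneg_of_le (Finset.sum_nonneg fun j _ => by positivity) le_rfl

end LowerBounds

/-! ### Occupation numbers -/

/-- Occupation numbers of the three modes. -/
abbrev Occ : Type := ℕ × ℕ × ℕ

namespace Occ

/-- The occupation number of mode `j`. -/
def num : Fin 3 → Occ → ℕ := ![fun i => i.1, fun i => i.2.1, fun i => i.2.2]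

/-- Add a quantum to mode `j`. -/
def up : Fin 3 → Occ → Occ :=
  ![fun i => (i.1 + 1, i.2.1, i.2.2), fun i => (i.1, i.2.1 + 1, i.2.2),
    fun i => (i.1, i.2.1, i.2.2 + 1)]

/-- Remove a quantum from mode `j`, if there is one. -/
def down : Fin 3 → Occ → Occ :=
  ![fun i => (i.1 - 1, i.2.1, i.2.2), fun i => (i.1, i.2.1 - 1, i.2.2),
    fun i => (i.1, i.2.1, i.2.2 - 1)]

/-- The total number of quanta. -/
def size (i : Occ) : ℕ := i.1 + i.2.1 + i.2.2

theorem down_up (j : Fin 3) (i : Occ) : down j (up j i) = i := by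
  fin_cases j <;> simp [up, down]

theorem up_down {j : Fin 3} {i : Occ} (h : num j i ≠ 0) : up j (down j i) = i := by
  obtain ⟨n, k, l⟩ := i
  fin_cases j <;> simp_all [up, down, num] <;> omega

theorem num_up (j : Fin 3) (i : Occ) : num j (up j i) = num j i + 1 := by
  fin_cases j <;> simp [up, num]

theorem num_down (j : Fin 3) (i : Occ) : num j (down j i) = num j i - 1 := by
  fin_cases j <;> simp [down, num]

theorem num_up_of_ne {j k : Fin 3} (h : j ≠ k) (i : Occ) : num j (up k i) = num j i := by
  fin_cases j <;> fin_cases k <;> simp_all [up, num]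

theorem num_down_of_ne {j k : Fin 3} (h : j ≠ k) (i : Occ) : num j (down k i) = num j i := by
  fin_cases j <;> fin_cases k <;> simp_all [down, num]

theorem up_up (j k : Fin 3) (i : Occ) : up j (up k i) = up k (up j i) := by
  fin_cases j <;> fin_cases k <;> simp [up]

theorem down_down (j k : Fin 3) (i : Occ) : down j (down k i) = down k (down j i) := by
  fin_cases j <;> fin_cases k <;> simp [down]

theorem up_down_of_ne {j k : Fin 3} (h : j ≠ k) (i : Occ) :
    up j (down k i) = down k (up j i) := by
  fin_cases j <;> fin_cases k <;> simp_all [up, down]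

theorem size_up (j : Fin 3) (i : Occ) : size (up j i) = size i + 1 := by
  fin_cases j <;> simp [up, size] <;> omega

theorem num_le_size (j : Fin 3) (i : Occ) : num j i ≤ size i := by
  fin_cases j <;> simp [num, size] <;> omega

theorem up_injective (j : Fin 3) : Function.Injective (up j) :=
  Function.LeftInverse.injective (down_up j)

/-- Two powers for each of the three modes: the reciprocal is dominated by a product of three
convergent one-mode series. -/
theorem summable_inv_size_pow : Summable fun i : Occ => (((size i : ℝ) + 1) ^ 6)⁻¹ := by
  have h1 : Summable fun n : ℕ => (((n : ℝ) + 1) ^ 2)⁻¹ := by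
    have := (summable_nat_add_iff 1).2 (Real.summable_nat_pow_inv.2 one_lt_two)
    simpa using this
  have h2 := h1.mul_of_nonneg (h1.mul_of_nonneg h1 (fun _ => by positivity)
    (fun _ => by positivity)) (fun _ => by positivity) (fun _ => by positivity)
  refine h2.of_nonneg_of_le (fun _ => by positivity) ?_
  rintro ⟨n, k, l⟩
  simp only [← mul_inv]
  gcongr
  simp only [size]
  push_cast
  have hn : ((n : ℝ) + 1) ^ 2 ≤ ((n : ℝ) + k + l + 1) ^ 2 := by
    gcongr; linarith [k.cast_nonneg (α := ℝ), l.cast_nonneg (α := ℝ)]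
  have hk : ((k : ℝ) + 1) ^ 2 ≤ ((n : ℝ) + k + l + 1) ^ 2 := by
    gcongr; linarith [n.cast_nonneg (α := ℝ), l.cast_nonneg (α := ℝ)]
  have hl : ((l : ℝ) + 1) ^ 2 ≤ ((n : ℝ) + k + l + 1) ^ 2 := by
    gcongr; linarith [k.cast_nonneg (α := ℝ), n.cast_nonneg (α := ℝ)]
  calc ((n : ℝ) + 1) ^ 2 * (((k : ℝ) + 1) ^ 2 * ((l : ℝ) + 1) ^ 2)
      ≤ ((n : ℝ) + k + l + 1) ^ 2 * (((n : ℝ) + k + l + 1) ^ 2 * ((n : ℝ) + k + l + 1) ^ 2) := by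
        gcongr
    _ = _ := by ring

end Occ

open Occ

/-! ### Ladder operators on families indexed by occupation numbers -/

section Sequences

variable {E : Type*} [NormedAddCommGroup E] [InnerProductSpace ℂ E]

/-- The annihilation operator of mode `j` on coefficient families. -/
def lower (j : Fin 3) : Module.End ℂ (Occ → E) where
  toFun v i := ((√(num j i + 1 : ℝ) : ℝ) : ℂ) • v (up j i)
  map_add' v w := by ext i; simp
  map_smul' c v := by ext i; simp [smul_comm c]

/-- The creation operator of mode `j` on coefficient families. -/
def raise (j : Fin 3) : Module.End ℂ (Occ → E) where
  toFun v i := ((√(num j i : ℝ) : ℝ) : ℂ) • v (down j i)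
  map_add' v w := by ext i; simp
  map_smul' c v := by ext i; simp [smul_comm c]

theorem lower_apply (j : Fin 3) (v : Occ → E) (i : Occ) :
    lower j v i = ((√(num j i + 1 : ℝ) : ℝ) : ℂ) • v (up j i) := rfl

theorem raise_apply (j : Fin 3) (v : Occ → E) (i : Occ) :
    raise j v i = ((√(num j i : ℝ) : ℝ) : ℂ) • v (down j i) := rfl

theorem sqrt_smul_sqrt_smul {x : ℝ} (hx : 0 ≤ x) (e : E) :
    ((√x : ℝ) : ℂ) • ((√x : ℝ) : ℂ) • e = (x : ℂ) • e := by
  rw [smul_smul, ← Complex.ofReal_mul, Real.mul_self_sqrt hx]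

theorem lower_mul_raise (j : Fin 3) :
    (lower j * raise j : Module.End ℂ (Occ → E)) = raise j * lower j + 1 := by
  ext v i
  simp only [Module.End.mul_apply, LinearMap.add_apply, Module.End.one_apply, Pi.add_apply,
    lower_apply, raise_apply, num_up, down_up, Nat.cast_add, Nat.cast_one]
  rw [sqrt_smul_sqrt_smul (by positivity)]
  -- At zero occupation the truncated `down` gives a meaningless index, but the coefficient √0
  -- removes that term.
  by_cases h : num j i = 0
  · simp [h]
  · have h1 : ((num j (down j i) : ℝ) + 1) = num j i := by
      rw [num_down]; exact_mod_cast Nat.succ_pred_eq_of_ne_zero h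
    rw [h1, up_down h, sqrt_smul_sqrt_smul (by positivity)]
    push_cast
    rw [add_smul, one_smul]

theorem commute_lower_lower (j k : Fin 3) :
    Commute (lower j : Module.End ℂ (Occ → E)) (lower k) := by
  rcases eq_or_ne j k with rfl | h
  · exact Commute.refl _
  · ext v i
    simp only [Module.End.mul_apply, lower_apply, num_up_of_ne h, num_up_of_ne h.symm, up_up j k]
    exact smul_comm _ _ _

theorem commute_raise_raise (j k : Fin 3) :
    Commute (raise j : Module.End ℂ (Occ → E)) (raise k) := by
  rcases eq_or_ne j k with rfl | h
  · exact Commute.refl _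
  · ext v i
    simp only [Module.End.mul_apply, raise_apply, num_down_of_ne h, num_down_of_ne h.symm,
      down_down j k]
    exact smul_comm _ _ _

theorem commute_lower_raise {j k : Fin 3} (h : j ≠ k) :
    Commute (lower j : Module.End ℂ (Occ → E)) (raise k) := by
  ext v i
  simp only [Module.End.mul_apply, raise_apply, lower_apply, num_down_of_ne h,
    num_up_of_ne h.symm, up_down_of_ne h]
  exact smul_comm _ _ _

/-- The families that decay faster than any power of the total number of quanta. -/
def rapid : Submodule ℂ (Occ → E) where
  carrier := {v | ∀ s : ℕ, ∃ C : ℝ, ∀ i, ((size i : ℝ) + 1) ^ s * ‖v i‖ ≤ C}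
  zero_mem' s := ⟨0, fun i => by simp⟩
  add_mem' {v w} hv hw s := by
    obtain ⟨C, hC⟩ := hv s
    obtain ⟨D, hD⟩ := hw s
    refine ⟨C + D, fun i => ?_⟩
    calc ((size i : ℝ) + 1) ^ s * ‖v i + w i‖ ≤ ((size i : ℝ) + 1) ^ s * (‖v i‖ + ‖w i‖) := by
          gcongr; exact norm_add_le _ _
      _ ≤ C + D := by rw [mul_add]; exact add_le_add (hC i) (hD i)
  smul_mem' c v hv s := by
    obtain ⟨C, hC⟩ := hv s
    refine ⟨‖c‖ * C, fun i => ?_⟩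
    rw [Pi.smul_apply, norm_smul, mul_left_comm]
    gcongr
    exact hC i

theorem sqrt_le_size {j : Fin 3} (i : Occ) : √(num j i + 1 : ℝ) ≤ (size i : ℝ) + 1 := by
  have h : (num j i : ℝ) ≤ size i := by exact_mod_cast num_le_size j i
  rw [Real.sqrt_le_left (by positivity)]
  nlinarith [(size i).cast_nonneg (α := ℝ)]

theorem lower_mem_rapid (j : Fin 3) : ∀ v ∈ rapid (E := E), lower j v ∈ rapid (E := E) := by
  intro v hv s
  obtain ⟨C, hC⟩ := hv (s + 1)
  refine ⟨C, fun i => le_trans ?_ (hC (up j i))⟩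
  rw [lower_apply, norm_smul, Complex.norm_real, Real.norm_of_nonneg (Real.sqrt_nonneg _),
    ← mul_assoc, size_up, pow_succ]
  have := sqrt_le_size (j := j) i
  push_cast
  gcongr
  · linarith
  · linarith

theorem raise_mem_rapid (j : Fin 3) : ∀ v ∈ rapid (E := E), raise j v ∈ rapid (E := E) := by
  intro v hv s
  obtain ⟨C, hC⟩ := hv (s + 1)
  have hC0 : 0 ≤ C := le_trans (by positivity) (hC 0)
  -- Raising shifts the index by one quantum, and size + 2 ≤ 2 (size + 1); the extra power of s pays
  -- for the square root.
  refine ⟨2 ^ (s + 1) * C, fun i => ?_⟩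
  rw [raise_apply, norm_smul, Complex.norm_real, Real.norm_of_nonneg (Real.sqrt_nonneg _)]
  by_cases h : num j i = 0
  · simp only [h, Nat.cast_zero, Real.sqrt_zero, zero_mul, mul_zero]; positivity
  obtain ⟨i, rfl⟩ : ∃ i', i = up j i' := ⟨down j i, (up_down h).symm⟩
  rw [down_up, num_up, size_up, ← mul_assoc]
  refine le_trans ?_ (mul_le_mul_of_nonneg_left (hC i) (by positivity))
  rw [← mul_assoc, ← mul_pow, pow_succ]
  have := sqrt_le_size (j := j) i
  have h0 := (size i).cast_nonneg (α := ℝ)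
  push_cast
  gcongr <;> linarith

/-- The annihilation operator on rapidly decaying families. -/
def lowerR (j : Fin 3) : Module.End ℂ (rapid (E := E)) := (lower j).restrict (lower_mem_rapid j)

/-- The creation operator on rapidly decaying families. -/
def raiseR (j : Fin 3) : Module.End ℂ (rapid (E := E)) := (raise j).restrict (raise_mem_rapid j)

theorem coe_lowerR (j : Fin 3) (v : rapid (E := E)) : (lowerR j v : Occ → E) = lower j v := rfl

theorem coe_raiseR (j : Fin 3) (v : rapid (E := E)) : (raiseR j v : Occ → E) = raise j v := rfl

theorem lowerR_mul_raiseR (j : Fin 3) :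
    (lowerR j * raiseR j : Module.End ℂ (rapid (E := E))) = raiseR j * lowerR j + 1 :=
  LinearMap.ext fun v => Subtype.ext (congrArg (· (v : Occ → E)) (lower_mul_raise j))

theorem commute_lowerR_lowerR (j k : Fin 3) :
    Commute (lowerR j : Module.End ℂ (rapid (E := E))) (lowerR k) :=
  LinearMap.ext fun v => Subtype.ext (congrArg (· (v : Occ → E)) (commute_lower_lower j k).eq)

theorem commute_raiseR_raiseR (j k : Fin 3) :
    Commute (raiseR j : Module.End ℂ (rapid (E := E))) (raiseR k) :=
  LinearMap.ext fun v => Subtype.ext (congrArg (· (v : Occ → E)) (commute_raise_raise j k).eq)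

theorem commute_lowerR_raiseR {j k : Fin 3} (h : j ≠ k) :
    Commute (lowerR j : Module.End ℂ (rapid (E := E))) (raiseR k) :=
  LinearMap.ext fun v => Subtype.ext (congrArg (· (v : Occ → E)) (commute_lower_raise h).eq)

theorem summable_sq_of_mem_rapid {v : Occ → E} (hv : v ∈ rapid (E := E)) :
    Summable fun i => ‖v i‖ ^ 2 := by
  obtain ⟨C, hC⟩ := hv 3
  refine (summable_inv_size_pow.mul_left (C ^ 2)).of_nonneg_of_le (fun _ => by positivity) ?_
  intro i
  rw [← div_eq_mul_inv, le_div_iff₀ (by positivity)]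
  calc ‖v i‖ ^ 2 * ((size i : ℝ) + 1) ^ 6 = (((size i : ℝ) + 1) ^ 3 * ‖v i‖) ^ 2 := by ring
    _ ≤ C ^ 2 := by gcongr; exact hC i

/-- Rapidly decaying families as square-summable families. -/
def toEll2 : rapid (E := E) →ₗ[ℂ] lp (fun _ : Occ => E) 2 where
  toFun v := ⟨(v : Occ → E), memℓp_gen (by simpa using summable_sq_of_mem_rapid v.2)⟩
  map_add' _ _ := rfl
  map_smul' _ _ := rfl

theorem toEll2_apply (v : rapid (E := E)) (i : Occ) : toEll2 v i = (v : Occ → E) i := rfl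

theorem norm_toEll2_sq (v : rapid (E := E)) : ‖toEll2 v‖ ^ 2 = ∑' i, ‖(v : Occ → E) i‖ ^ 2 := by
  have := lp.norm_rpow_eq_tsum (p := 2) (by norm_num) (toEll2 v)
  simpa [toEll2_apply] using this

theorem inner_lowerR (j : Fin 3) (v w : rapid (E := E)) :
    ⟪toEll2 (lowerR j v), toEll2 w⟫_ℂ = ⟪toEll2 v, toEll2 (raiseR j w)⟫_ℂ := by
  rw [lp.inner_eq_tsum, lp.inner_eq_tsum]
  simp only [toEll2_apply, coe_lowerR, coe_raiseR]
  -- Reindexing along `up j` loses nothing: indices outside its range have no quantum in mode j, and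
  -- `raise j` vanishes there.
  rw [← (up_injective j).tsum_eq (f := fun i => ⟪(v : Occ → E) i, raise j (w : Occ → E) i⟫_ℂ)]
  · refine tsum_congr fun i => ?_
    rw [lower_apply, raise_apply, inner_smul_left, inner_smul_right, down_up, num_up]
    simp
  · intro i hi
    by_cases h : num j i = 0
    · simp [raise_apply, h] at hi
    · exact ⟨_, up_down h⟩

/-! ### Regularization -/

/-- The operator `t ^ N`, where `N` is the total number of quanta. -/
def damp (t : ℝ) : Module.End ℂ (Occ → E) where
  toFun v i := ((t ^ size i : ℝ) : ℂ) • v i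
  map_add' v w := by ext i; simp
  map_smul' c v := by ext i; simp [smul_comm c]

theorem damp_apply (t : ℝ) (v : Occ → E) (i : Occ) :
    damp t v i = ((t ^ size i : ℝ) : ℂ) • v i := rfl

theorem norm_damp_sq (t : ℝ) (v : Occ → E) (i : Occ) :
    ‖damp t v i‖ ^ 2 = (t ^ size i) ^ 2 * ‖v i‖ ^ 2 := by
  rw [damp_apply, norm_smul, mul_pow, Complex.norm_real, Real.norm_eq_abs, sq_abs]

theorem damp_mem_rapid {t : ℝ} (h0 : 0 < t) (h1 : t < 1) {v : Occ → E} {C : ℝ}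
    (hv : ∀ i, ‖v i‖ ≤ C) : damp t v ∈ rapid (E := E) := by
  intro s
  -- The sequence n^s t^n is bounded. It is evaluated at size + 1, which costs the factor t⁻¹ in the
  -- constant.
  have h := (tendsto_pow_const_mul_const_pow_of_abs_lt_one s (r := t)
    (by rwa [abs_of_pos h0])).comp (Filter.tendsto_add_atTop_nat 1)
  obtain ⟨D, hD⟩ := h.bddAbove_range
  have hC : 0 ≤ C := (norm_nonneg _).trans (hv 0)
  refine ⟨t⁻¹ * D * C, fun i => ?_⟩
  rw [damp_apply, norm_smul, Complex.norm_real, Real.norm_of_nonneg (by positivity), ← mul_assoc]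
  have hD' := hD ⟨size i, rfl⟩
  simp only [Function.comp, Nat.cast_add, Nat.cast_one] at hD'
  have : ((size i : ℝ) + 1) ^ s * t ^ size i ≤ t⁻¹ * D := by
    rw [le_inv_mul_iff₀ h0]
    calc _ = ((size i : ℝ) + 1) ^ s * t ^ (size i + 1) := by ring
      _ ≤ D := hD'
  exact mul_le_mul this (hv i) (norm_nonneg _) (le_trans (by positivity) this)

/-- The operator `a + b† + c†` on coefficient families, which expresses the action of
`a† + b + c` on number states. -/
def ladder : Module.End ℂ (Occ → E) := lower 0 + (raise 1 + raise 2)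

/-- The damped version of `ladder`. -/
def dampedLadder (t : ℝ) : Module.End ℂ (rapid (E := E)) :=
  ((t⁻¹ : ℝ) : ℂ) • lowerR 0 + (t : ℂ) • (raiseR 1 + raiseR 2)

/-- Annihilation lowers N by one, so t^N passes it at the price of t⁻¹. Creation costs t in
`damp_raise`. Hence `ladder` conjugated by t^N is `dampedLadder t`. -/
theorem damp_lower {t : ℝ} (ht : t ≠ 0) (j : Fin 3) (v : Occ → E) :
    damp t (lower j v) = ((t⁻¹ : ℝ) : ℂ) • lower j (damp t v) := by
  ext i
  simp only [damp_apply, lower_apply, Pi.smul_apply, size_up, smul_smul]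
  congr 1
  have : (t : ℂ) ≠ 0 := by exact_mod_cast ht
  push_cast
  field_simp
  ring

theorem damp_raise (t : ℝ) (j : Fin 3) (v : Occ → E) :
    damp t (raise j v) = (t : ℂ) • raise j (damp t v) := by
  ext i
  by_cases h : num j i = 0
  · simp [damp_apply, raise_apply, h]
  obtain ⟨i, rfl⟩ : ∃ i', i = up j i' := ⟨down j i, (up_down h).symm⟩
  simp only [damp_apply, raise_apply, Pi.smul_apply, size_up, smul_smul, down_up]
  congr 1
  push_cast
  ring

theorem damp_ladder {t : ℝ} (ht : t ≠ 0) {v : Occ → E} {u : rapid (E := E)}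
    (h : damp t v = u) : damp t (ladder v) = (dampedLadder t u : rapid (E := E)) := by
  simp only [ladder, dampedLadder, LinearMap.add_apply, LinearMap.smul_apply, map_add,
    damp_lower ht, damp_raise, h, Submodule.coe_add, Submodule.coe_smul, coe_lowerR, coe_raiseR,
    smul_add]

theorem damp_ladder_pow {t : ℝ} (ht : t ≠ 0) {v : Occ → E} {u : rapid (E := E)}
    (h : damp t v = u) (m : ℕ) :
    damp t ((ladder ^ m) v) = ((dampedLadder t ^ m) u : rapid (E := E)) := by
  induction m with
  | zero => simpa using h
  | succ m ih =>
    rw [pow_succ', pow_succ', Module.End.mul_apply, Module.End.mul_apply, damp_ladder ht ih]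

/-- A lower bound for damped families yields one for bounded families. -/
theorem tsum_ladder_ge_of_damped {v : Occ → E} {C : ℝ} (hv : ∀ i, ‖v i‖ ≤ C) (m : ℕ)
    {κ : ℝ → ℝ} (hκ : ContinuousAt κ 1)
    (h : ∀ᶠ t in nhdsWithin (1 : ℝ) (Set.Iio 1), 0 < t → t < 1 → ∀ u : rapid (E := E),
      damp t v = u → κ t * ‖toEll2 u‖ ^ 2 ≤ ‖toEll2 ((dampedLadder t ^ m) u)‖ ^ 2) :
    ENNReal.ofReal (κ 1) * ∑' i, ENNReal.ofReal (‖v i‖ ^ 2) ≤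
      ∑' i, ENNReal.ofReal (‖(ladder ^ m) v i‖ ^ 2) := by
  rw [ENNReal.tsum_eq_iSup_sum, ENNReal.mul_iSup]
  refine iSup_le fun F => ?_
  -- If the right-hand side is infinite there is nothing to prove; otherwise it is a convergent real
  -- series, which can dominate the damped ones.
  by_cases htop : ∑' i, ENNReal.ofReal (‖(ladder ^ m) v i‖ ^ 2) = ⊤
  · rw [htop]; exact le_top
  have hsum : Summable fun i => ‖(ladder ^ m) v i‖ ^ 2 := by
    have := ENNReal.summable_toReal htop
    simpa [ENNReal.toReal_ofReal (sq_nonneg _)] using this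
  rw [← ENNReal.ofReal_tsum_of_nonneg (fun _ => by positivity) hsum,
    ← ENNReal.ofReal_sum_of_nonneg (fun _ _ => by positivity),
    ← ENNReal.ofReal_mul' (Finset.sum_nonneg fun _ _ => by positivity)]
  refine ENNReal.ofReal_le_ofReal ?_
  -- Damping only decreases the right-hand series, and truncation to the finite set F only decreases
  -- the left-hand one. On F the limit t → 1 is a limit of a finite sum, so no interchange of limits
  -- is needed.
  have hev : ∀ᶠ t in nhdsWithin (1 : ℝ) (Set.Iio 1), 0 < κ t →
      κ t * ∑ i ∈ F, (t ^ size i) ^ 2 * ‖v i‖ ^ 2 ≤ ∑' i, ‖(ladder ^ m) v i‖ ^ 2 := by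
    have hpos : ∀ᶠ t in nhdsWithin (1 : ℝ) (Set.Iio 1), 0 < t :=
      nhdsWithin_le_nhds (lt_mem_nhds one_pos)
    filter_upwards [h, hpos, self_mem_nhdsWithin] with t ht h0 h1 hκt
    have h1 : t < 1 := h1
    obtain ⟨u, hu⟩ : ∃ u : rapid (E := E), damp t v = u := ⟨⟨_, damp_mem_rapid h0 h1 hv⟩, rfl⟩
    have hb := ht h0 h1 u hu
    rw [norm_toEll2_sq, norm_toEll2_sq, ← damp_ladder_pow h0.ne' hu, ← hu] at hb
    simp only [norm_damp_sq] at hb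
    have hle : ∀ i, (t ^ size i) ^ 2 * ‖(ladder ^ m) v i‖ ^ 2 ≤ ‖(ladder ^ m) v i‖ ^ 2 := fun i =>
      mul_le_of_le_one_left (by positivity) (pow_le_one₀ (by positivity)
        (pow_le_one₀ h0.le h1.le))
    have hs1 : Summable fun i => (t ^ size i) ^ 2 * ‖v i‖ ^ 2 := by
      simpa only [← hu, norm_damp_sq] using summable_sq_of_mem_rapid u.2
    have hs2 := hsum.of_nonneg_of_le (fun i => by positivity) hle
    calc _ ≤ κ t * ∑' i, (t ^ size i) ^ 2 * ‖v i‖ ^ 2 := by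
          gcongr
          exact hs1.sum_le_tsum _ fun i _ => by positivity
      _ ≤ _ := hb
      _ ≤ _ := hs2.tsum_le_tsum hle hsum
  rcases le_or_gt (κ 1) 0 with hκ0 | hκ0
  · exact (mul_nonpos_of_nonpos_of_nonneg hκ0 (Finset.sum_nonneg fun _ _ => by positivity)).trans
      (tsum_nonneg fun _ => by positivity)
  have hlim : Filter.Tendsto (fun t => κ t * ∑ i ∈ F, (t ^ size i) ^ 2 * ‖v i‖ ^ 2)
      (nhdsWithin (1 : ℝ) (Set.Iio 1)) (nhds (κ 1 * ∑ i ∈ F, ‖v i‖ ^ 2)) := by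
    have hc : ContinuousAt (fun t : ℝ => κ t * ∑ i ∈ F, (t ^ size i) ^ 2 * ‖v i‖ ^ 2) 1 :=
      hκ.mul (by fun_prop)
    have := hc.tendsto.mono_left (nhdsWithin_le_nhds (s := Set.Iio 1))
    simpa using this
  refine le_of_tendsto hlim ?_
  filter_upwards [hev, nhdsWithin_le_nhds (hκ.eventually (lt_mem_nhds hκ0))] with t ht hp
  exact ht hp

/-! ### The bound for all families -/

/-- The adjoint of `dampedLadder t`. -/
def dampedLadderAdj (t : ℝ) : Module.End ℂ (rapid (E := E)) :=
  ((t⁻¹ : ℝ) : ℂ) • raiseR 0 + (t : ℂ) • (lowerR 1 + lowerR 2)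

theorem inner_raiseR (j : Fin 3) (v w : rapid (E := E)) :
    ⟪toEll2 (raiseR j v), toEll2 w⟫_ℂ = ⟪toEll2 v, toEll2 (lowerR j w)⟫_ℂ :=
  inner_adjoint_symm toEll2 (inner_lowerR j) v w

theorem inner_dampedLadder (t : ℝ) (v w : rapid (E := E)) :
    ⟪toEll2 (dampedLadder t v), toEll2 w⟫_ℂ = ⟪toEll2 v, toEll2 (dampedLadderAdj t w)⟫_ℂ := by
  simp only [dampedLadder, dampedLadderAdj, LinearMap.add_apply, LinearMap.smul_apply, map_add,
    map_smul, inner_add_left, inner_add_right, inner_smul_left, inner_smul_right, inner_lowerR,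
    inner_raiseR, Complex.conj_ofReal]

theorem lowerR_add_mul_raiseR_add :
    ((lowerR 1 + lowerR 2) * (raiseR 1 + raiseR 2) : Module.End ℂ (rapid (E := E))) =
      (raiseR 1 + raiseR 2) * (lowerR 1 + lowerR 2) + 2 := by
  simp only [add_mul, mul_add, lowerR_mul_raiseR,
    (commute_lowerR_raiseR (E := E) (show (1 : Fin 3) ≠ 2 by decide)).eq,
    (commute_lowerR_raiseR (E := E) (show (2 : Fin 3) ≠ 1 by decide)).eq]
  rw [show (2 : Module.End ℂ (rapid (E := E))) = 1 + 1 from one_add_one_eq_two.symm]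
  abel

/-- Modes 1 and 2 contribute t² each; mode 0 enters with creation and annihilation reversed and
contributes -t⁻². The total tends to 1 as t → 1, and is positive near 1. -/
theorem commutator_dampedLadder (t : ℝ) :
    (dampedLadderAdj t * dampedLadder t : Module.End ℂ (rapid (E := E))) =
      dampedLadder t * dampedLadderAdj t +
        algebraMap ℂ _ ((2 * t ^ 2 - (t⁻¹) ^ 2 : ℝ) : ℂ) := by
  have h1 := lowerR_mul_raiseR (E := E) 0
  have h2 := lowerR_add_mul_raiseR_add (E := E)
  have h3 : Commute (raiseR 0 : Module.End ℂ (rapid (E := E))) (raiseR 1 + raiseR 2) :=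
    (commute_raiseR_raiseR 0 1).add_right (commute_raiseR_raiseR 0 2)
  have h4 : Commute (lowerR 0 : Module.End ℂ (rapid (E := E))) (lowerR 1 + lowerR 2) :=
    (commute_lowerR_lowerR 0 1).add_right (commute_lowerR_lowerR 0 2)
  rw [Algebra.algebraMap_eq_smul_one, dampedLadder, dampedLadderAdj]
  generalize (lowerR 1 + lowerR 2 : Module.End ℂ (rapid (E := E))) = D at *
  generalize (raiseR 1 + raiseR 2 : Module.End ℂ (rapid (E := E))) = D' at *
  simp only [add_mul, mul_add, smul_mul_smul_comm, h1, h2, h3.eq,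
    h4.eq]
  have h2' : (2 : Module.End ℂ (rapid (E := E))) = (2 : ℂ) • 1 := by
    rw [two_smul, one_add_one_eq_two]
  rw [h2']
  push_cast
  module

theorem tsum_ladder_ge {v : Occ → E} {C : ℝ} (hv : ∀ i, ‖v i‖ ≤ C) (m : ℕ) :
    (m.factorial : ℝ≥0∞) * ∑' i, ENNReal.ofReal (‖v i‖ ^ 2) ≤
      ∑' i, ENNReal.ofReal (‖(ladder ^ m) v i‖ ^ 2) := by
  have hc : ContinuousAt (fun t : ℝ => 2 * t ^ 2 - (t⁻¹) ^ 2) 1 := by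
    have : ContinuousAt (fun t : ℝ => t⁻¹) 1 := continuousAt_inv₀ one_ne_zero
    fun_prop
  have := tsum_ladder_ge_of_damped hv m (κ := fun t => m.factorial * (2 * t ^ 2 - (t⁻¹) ^ 2) ^ m)
    (by fun_prop) ?_
  · norm_num at this ⊢
    exact this
  · have hpos : ∀ᶠ t in nhdsWithin (1 : ℝ) (Set.Iio 1), (0 : ℝ) < 2 * t ^ 2 - (t⁻¹) ^ 2 :=
      nhdsWithin_le_nhds (hc.eventually (lt_mem_nhds (by norm_num)))
    filter_upwards [hpos] with t ht _ _ u _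
    exact norm_pow_ge_of_commutator toEll2 (inner_dampedLadder t) ht.le
      (commutator_dampedLadder t) m u

/-! ### The bound for families of product form -/

/-- A multiple of the annihilation operator of mode `0`. -/
def scaledLower (c : ℝ) : Module.End ℂ (Occ → E) := (c : ℂ) • lower 0

/-- A multiple of the sum of the annihilation operators of the modes `1` and `2`. -/
def scaledLowerAdd (c : ℝ) : Module.End ℂ (Occ → E) := (c : ℂ) • (lower 1 + lower 2)

/-- `scaledLower` on rapidly decaying families. -/
def scaledLowerR (c : ℝ) : Module.End ℂ (rapid (E := E)) := (c : ℂ) • lowerR 0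

/-- `scaledLowerAdd` on rapidly decaying families. -/
def scaledLowerAddR (c : ℝ) : Module.End ℂ (rapid (E := E)) := (c : ℂ) • (lowerR 1 + lowerR 2)

/-- `Φ` and `Φ'` are partial transposes of `v` and `v'` with respect to mode `0`. -/
def IsTranspose (v v' Φ Φ' : Occ → E) : Prop :=
  ∀ (n n' : ℕ) (k k' : ℕ × ℕ), ⟪v (n, k), v' (n', k')⟫_ℂ = ⟪Φ (n', k), Φ' (n, k')⟫_ℂ

namespace IsTranspose

variable {v v' Φ Φ' : Occ → E}

theorem symm (h : IsTranspose v v' Φ Φ') : IsTranspose v' v Φ' Φ := by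
  intro n n' k k'
  rw [← inner_conj_symm, h, inner_conj_symm]

/-- Transposition exchanges the mode-0 indices of the two slots, so an operator of mode 0 on the
left of one pair acts on the right of the other. Operators of modes 1 and 2 keep their slot, as in
`lower_add_left`. -/
theorem lower_zero_left (h : IsTranspose v v' Φ Φ') (c : ℝ) :
    IsTranspose (scaledLower c v) v' Φ (scaledLower c Φ') := by
  intro n n' k k'
  simp only [scaledLower, LinearMap.smul_apply, Pi.smul_apply, lower_apply, inner_smul_left,
    inner_smul_right, Complex.conj_ofReal]
  exact congrArg (fun z => (c : ℂ) * (_ * z)) (h (n + 1) n' k k')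

theorem lower_zero_left_pow (h : IsTranspose v v' Φ Φ') (c : ℝ) (p : ℕ) :
    IsTranspose ((scaledLower c ^ p) v) v' Φ ((scaledLower c ^ p) Φ') := by
  induction p with
  | zero => exact h
  | succ p ih => rw [pow_succ']; exact ih.lower_zero_left c

theorem lower_add_left (h : IsTranspose v v' Φ Φ') (c : ℝ) :
    IsTranspose (scaledLowerAdd c v) v' (scaledLowerAdd c Φ) Φ' := by
  intro n n' k k'
  simp only [scaledLowerAdd, LinearMap.smul_apply, LinearMap.add_apply, Pi.add_apply, Pi.smul_apply,
    lower_apply, inner_smul_left, inner_add_left, Complex.conj_ofReal]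
  exact congrArg₂ (fun z w => (c : ℂ) * (_ * z + _ * w)) (h n n' (k.1 + 1, k.2) k')
    (h n n' (k.1, k.2 + 1) k')

theorem lower_add_left_pow (h : IsTranspose v v' Φ Φ') (c : ℝ) (p : ℕ) :
    IsTranspose ((scaledLowerAdd c ^ p) v) v'
      ((scaledLowerAdd c ^ p) Φ) Φ' := by
  induction p with
  | zero => exact h
  | succ p ih => rw [pow_succ']; exact ih.lower_add_left c

theorem damped (h : IsTranspose v v' Φ Φ') (t : ℝ) :
    IsTranspose (damp t v) (ThreeMode.damp t v') (ThreeMode.damp t Φ) (ThreeMode.damp t Φ') := by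
  intro n n' k k'
  simp only [damp_apply, inner_smul_left, inner_smul_right, Complex.conj_ofReal, h n n' k k', size]
  push_cast
  ring

theorem norm_eq (h : IsTranspose v v Φ Φ) (i : Occ) : ‖v i‖ = ‖Φ i‖ := by
  have := h i.1 i.1 i.2 i.2
  rw [inner_self_eq_norm_sq_to_K, inner_self_eq_norm_sq_to_K] at this
  have h2 : ‖v i‖ ^ 2 = ‖Φ i‖ ^ 2 := by exact_mod_cast this
  exact (sq_eq_sq₀ (norm_nonneg _) (norm_nonneg _)).1 h2

theorem pow_pow (h : IsTranspose v v Φ Φ) (c d : ℝ) (p q x y : ℕ) :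
    IsTranspose ((scaledLower c ^ p) ((scaledLowerAdd d ^ x) v))
      ((scaledLower c ^ q) ((scaledLowerAdd d ^ y) v))
      ((scaledLower c ^ q) ((scaledLowerAdd d ^ x) Φ))
      ((scaledLower c ^ p) ((scaledLowerAdd d ^ y) Φ)) :=
  ((((h.lower_add_left_pow d x).symm.lower_add_left_pow d y).symm.lower_zero_left_pow c
    p).symm.lower_zero_left_pow c q).symm

end IsTranspose

theorem coe_lowerR_pow_mul_pow (c d : ℝ) (p x : ℕ) (u : rapid (E := E)) :
    (((scaledLowerR c ^ p * scaledLowerAddR d ^ x : Module.End ℂ (rapid (E := E))) u :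
      rapid (E := E)) : Occ → E) = (scaledLower c ^ p) ((scaledLowerAdd d ^ x) u) := by
  have h1 : ∀ w : rapid (E := E), (((scaledLowerAddR d ^ x) w : rapid (E := E)) :
      Occ → E) = (scaledLowerAdd d ^ x) w := by
    induction x with
    | zero => intro w; rfl
    | succ x ih => intro w; rw [pow_succ, pow_succ, Module.End.mul_apply, ih]; rfl
  have h2 : ∀ w : rapid (E := E), (((scaledLowerR c ^ p) w : rapid (E := E)) :
      Occ → E) = (scaledLower c ^ p) w := by
    induction p with
    | zero => intro w; rfl
    | succ x ih => intro w; rw [pow_succ, pow_succ, Module.End.mul_apply, ih]; rfl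
  rw [Module.End.mul_apply, h2, h1]

/-- Damping is diagonal with real entries and preserves the transpose relation. The factor t⁻¹ of
mode 0 does not enter the constant: mode 0 commutes with the other two, whose commutator is 2 t². -/
theorem tsum_ladder_ge_of_isTranspose {v Φ : Occ → E} {C : ℝ} (hv : ∀ i, ‖v i‖ ≤ C)
    (hvΦ : IsTranspose v v Φ Φ) (m : ℕ) :
    (m.factorial * 2 ^ m : ℝ≥0∞) * ∑' i, ENNReal.ofReal (‖v i‖ ^ 2) ≤
      ∑' i, ENNReal.ofReal (‖(ladder ^ m) v i‖ ^ 2) := by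
  have := tsum_ladder_ge_of_damped hv m (κ := fun t => m.factorial * (2 * t ^ 2) ^ m)
    (by fun_prop) ?_
  · norm_num at this ⊢
    exact this
  · refine Filter.Eventually.of_forall fun t h0 h1 u hu => ?_
    have hΦ : ∀ i, ‖Φ i‖ ≤ C := fun i => by rw [← hvΦ.norm_eq]; exact hv i
    obtain ⟨w, hw⟩ : ∃ w : rapid (E := E), ThreeMode.damp t Φ = w :=
      ⟨⟨_, damp_mem_rapid h0 h1 hΦ⟩, rfl⟩
    have huw : IsTranspose (u : Occ → E) u w w := by
      rw [← hu, ← hw]; exact hvΦ.damped t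
    have hnorm : ‖toEll2 u‖ ^ 2 = ‖toEll2 w‖ ^ 2 := by
      rw [norm_toEll2_sq, norm_toEll2_sq]
      simp only [huw.norm_eq]
    rw [hnorm, dampedLadder, smul_add]
    have key := norm_add_pow_ge_of_transpose toEll2 (A := scaledLowerR t⁻¹)
      (D := scaledLowerAddR t) (D' := (t : ℂ) • (raiseR 1 + raiseR 2))
      (κ := 2 * t ^ 2) ?_ (by positivity) ?_ ?_ ?_ (v := u) (v' := w) ?_ m
    · rwa [scaledLowerR, smul_add] at key
    · intro v w
      simp only [scaledLowerAddR, LinearMap.add_apply, LinearMap.smul_apply, map_add, map_smul,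
        inner_add_left, inner_add_right, inner_smul_left, inner_smul_right, inner_lowerR,
        Complex.conj_ofReal]
    · rw [scaledLowerAddR, smul_mul_smul_comm, lowerR_add_mul_raiseR_add,
        smul_mul_smul_comm, smul_add,
        Algebra.algebraMap_eq_smul_one]
      congr 1
      rw [show (2 : Module.End ℂ (rapid (E := E))) = (2 : ℂ) • 1 by
        rw [two_smul, one_add_one_eq_two], smul_smul]
      congr 1
      push_cast; ring
    · exact (((commute_lowerR_lowerR 0 1).add_right
        (commute_lowerR_lowerR 0 2)).smul_left _).smul_right _
    · exact (((commute_lowerR_raiseR (by decide)).add_right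
        (commute_lowerR_raiseR (by decide))).smul_left _).smul_right _
    · intro p q x y
      -- The ℓ² inner product uses only equal indices in the two slots, where exchanging the mode-0
      -- indices has no effect; only the operators have changed places.
      rw [lp.inner_eq_tsum, lp.inner_eq_tsum]
      refine tsum_congr fun i => ?_
      simp only [toEll2_apply, coe_lowerR_pow_mul_pow]
      exact IsTranspose.pow_pow huw _ _ p q x y i.1 i.1 i.2 i.2

end Sequences

/-! ### Tensor products of Schwartz functions -/

section Tensor

variable {D E : Type*} [NormedAddCommGroup D] [NormedSpace ℝ D] [NormedAddCommGroup E]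
  [NormedSpace ℝ E]

theorem norm_iteratedFDeriv_comp_clm_le {G F : Type*} [NormedAddCommGroup G] [NormedSpace ℝ G]
    [NormedAddCommGroup F] [NormedSpace ℝ F] {f : E → F} (hf : ContDiff ℝ (⊤ : ℕ∞) f)
    (L : G →L[ℝ] E) (hL : ‖L‖ ≤ 1) (x : G) (n : ℕ) :
    ‖iteratedFDeriv ℝ n (fun y => f (L y)) x‖ ≤ ‖iteratedFDeriv ℝ n f (L x)‖ := by
  have h : iteratedFDeriv ℝ n (fun y => f (L y)) x =
      (iteratedFDeriv ℝ n f (L x)).compContinuousLinearMap fun _ => L :=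
    L.iteratedFDeriv_comp_right hf x (by exact_mod_cast le_top)
  rw [h]
  refine (ContinuousMultilinearMap.norm_compContinuousLinearMap_le _ _).trans ?_
  refine mul_le_of_le_one_right (norm_nonneg _) ?_
  exact Finset.prod_le_one (fun _ _ => norm_nonneg _) fun _ _ => hL

theorem tensor_decay (f : 𝓢(D, ℂ)) (g : 𝓢(E, ℂ)) (k n : ℕ) :
    ∃ C : ℝ, ∀ x : D × E,
      ‖x‖ ^ k * ‖iteratedFDeriv ℝ n (fun y : D × E => f y.1 * g y.2) x‖ ≤ C := by
  choose A _ hA using f.decay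
  choose B _ hB using g.decay
  refine ⟨∑ i ∈ Finset.range (n + 1), n.choose i * (A k i * B 0 (n - i) + A 0 i * B k (n - i)),
    fun x => ?_⟩
  have hf : ContDiff ℝ (⊤ : ℕ∞) fun y : D × E => f y.1 := (f.smooth ⊤).comp contDiff_fst
  have hg : ContDiff ℝ (⊤ : ℕ∞) fun y : D × E => g y.2 := (g.smooth ⊤).comp contDiff_snd
  have hmul := norm_iteratedFDeriv_mul_le hf hg x (n := n) (by exact_mod_cast le_top)
  refine (mul_le_mul_of_nonneg_left hmul (by positivity)).trans ?_
  rw [Finset.mul_sum]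
  refine Finset.sum_le_sum fun i _ => ?_
  have h1 := norm_iteratedFDeriv_comp_clm_le (f.smooth ⊤) (ContinuousLinearMap.fst ℝ D E)
    (ContinuousLinearMap.norm_fst_le ℝ D E) x i
  have h2 := norm_iteratedFDeriv_comp_clm_le (g.smooth ⊤) (ContinuousLinearMap.snd ℝ D E)
    (ContinuousLinearMap.norm_snd_le ℝ D E) x (n - i)
  simp only [ContinuousLinearMap.coe_fst', ContinuousLinearMap.coe_snd'] at h1 h2
  -- The product carries the maximum norm, so the weight in the Leibniz estimate can be charged to
  -- one of the two factors.
  have h3 : ‖x‖ ^ k ≤ ‖x.1‖ ^ k + ‖x.2‖ ^ k := by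
    rcases le_total ‖x.1‖ ‖x.2‖ with h | h
    · rw [Prod.norm_def, max_eq_right h]; exact le_add_of_nonneg_left (by positivity)
    · rw [Prod.norm_def, max_eq_left h]; exact le_add_of_nonneg_right (by positivity)
  have a0 := hA 0 i x.1
  have ak := hA k i x.1
  have b0 := hB 0 (n - i) x.2
  have bk := hB k (n - i) x.2
  rw [pow_zero, one_mul] at a0 b0
  have hA0 : 0 ≤ A k i := le_trans (by positivity) ak
  have hA1 : 0 ≤ A 0 i := le_trans (by positivity) a0
  set a := ‖iteratedFDeriv ℝ i f x.1‖
  set b := ‖iteratedFDeriv ℝ (n - i) g x.2‖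
  calc ‖x‖ ^ k * (n.choose i * ‖iteratedFDeriv ℝ i (fun y : D × E => f y.1) x‖ *
        ‖iteratedFDeriv ℝ (n - i) (fun y : D × E => g y.2) x‖)
      ≤ (‖x.1‖ ^ k + ‖x.2‖ ^ k) * (n.choose i * a * b) := by gcongr
    _ = n.choose i * ((‖x.1‖ ^ k * a) * b + a * (‖x.2‖ ^ k * b)) := by ring
    _ ≤ n.choose i * (A k i * B 0 (n - i) + A 0 i * B k (n - i)) := by gcongr

/-- The Schwartz function `(x, y) ↦ f x * g y`. -/
def tensorS (f : 𝓢(D, ℂ)) (g : 𝓢(E, ℂ)) : 𝓢(D × E, ℂ) where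
  toFun y := f y.1 * g y.2
  smooth' := ((f.smooth ⊤).comp contDiff_fst).mul ((g.smooth ⊤).comp contDiff_snd)
  decay' := tensor_decay f g

theorem tensorS_apply (f : 𝓢(D, ℂ)) (g : 𝓢(E, ℂ)) (x : D × E) :
    tensorS f g x = f x.1 * g x.2 := rfl

end Tensor

/-! ### The Gaussian on the line -/

theorem pow_mul_gaussian_bound (k : ℕ) :
    ∃ C : ℝ, ∀ x : ℝ, |x| ^ k * Real.exp (-(x ^ 2 / 2)) ≤ C := by
  -- From |x|^k ≤ k! exp |x| and |x| - x²/2 ≤ 1/2, the latter by completing the square.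
  refine ⟨k.factorial * Real.exp 2⁻¹, fun x => ?_⟩
  have h1 : |x| ^ k ≤ k.factorial * Real.exp |x| := by
    have := Real.pow_div_factorial_le_exp |x| (abs_nonneg x) k
    rwa [div_le_iff₀' (by positivity)] at this
  calc |x| ^ k * Real.exp (-(x ^ 2 / 2))
      ≤ k.factorial * Real.exp |x| * Real.exp (-(x ^ 2 / 2)) := by gcongr
    _ = k.factorial * Real.exp (|x| + -(x ^ 2 / 2)) := by rw [Real.exp_add]; ring
    _ ≤ k.factorial * Real.exp 2⁻¹ := by
        gcongr
        nlinarith [sq_nonneg (|x| - 1), sq_abs x]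

theorem polynomial_mul_gaussian_bound (P : Polynomial ℤ) (k : ℕ) :
    ∃ C : ℝ, ∀ x : ℝ, |x| ^ k * |Polynomial.aeval x P * Real.exp (-(x ^ 2 / 2))| ≤ C := by
  induction P using Polynomial.induction_on' with
  | add P Q hP hQ =>
    obtain ⟨C, hC⟩ := hP
    obtain ⟨D, hD⟩ := hQ
    refine ⟨C + D, fun x => ?_⟩
    rw [map_add, add_mul]
    calc _ ≤ |x| ^ k * (|Polynomial.aeval x P * Real.exp (-(x ^ 2 / 2))| +
          |Polynomial.aeval x Q * Real.exp (-(x ^ 2 / 2))|) := by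
          gcongr; exact abs_add_le _ _
      _ ≤ C + D := by rw [mul_add]; exact add_le_add (hC x) (hD x)
  | monomial n a =>
    obtain ⟨C, hC⟩ := pow_mul_gaussian_bound (k + n)
    refine ⟨|(a : ℝ)| * C, fun x => ?_⟩
    have hval : Polynomial.aeval x (Polynomial.monomial n a) = (a : ℝ) * x ^ n := by
      simp [Polynomial.aeval_monomial]
    rw [hval, abs_mul, abs_mul, abs_pow, Real.abs_exp]
    calc _ = |(a : ℝ)| * (|x| ^ (k + n) * Real.exp (-(x ^ 2 / 2))) := by ring
      _ ≤ _ := by gcongr; exact hC x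

/-- The function `exp (-x² / 2)` as a Schwartz function. -/
def gaussianReal : 𝓢(ℝ, ℝ) where
  toFun x := Real.exp (-(x ^ 2 / 2))
  smooth' := by fun_prop
  decay' k n := by
    obtain ⟨C, hC⟩ := polynomial_mul_gaussian_bound (Polynomial.hermite n) k
    refine ⟨C, fun x => le_trans (le_of_eq ?_) (hC x)⟩
    rw [norm_iteratedFDeriv_eq_norm_iteratedDeriv, iteratedDeriv_eq_iterate,
      Polynomial.deriv_gaussian_eq_hermite_mul_gaussian]
    simp [abs_mul]

/-- The vacuum wave function `π^(-1/4) exp (-x² / 2)` of one mode. -/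
def vacuum : 𝓢(ℝ, ℂ) :=
  ((Real.pi ^ (-(1 / 4) : ℝ) : ℝ) : ℂ) • gaussianReal.postcompCLM Complex.ofRealCLM

theorem vacuum_apply (x : ℝ) :
    vacuum x = ((Real.pi ^ (-(1 / 4) : ℝ) * Real.exp (-(x ^ 2 / 2)) : ℝ) : ℂ) := by
  simp only [vacuum, smul_apply, SchwartzMap.postcompCLM_apply, smul_eq_mul,
    Complex.ofReal_mul]
  rfl

theorem hasDerivAt_vacuum (x : ℝ) : HasDerivAt vacuum (-(x : ℂ) * vacuum x) x := by
  have h : HasDerivAt (fun x : ℝ => Real.pi ^ (-(1 / 4) : ℝ) * Real.exp (-(x ^ 2 / 2)))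
      (Real.pi ^ (-(1 / 4) : ℝ) * (Real.exp (-(x ^ 2 / 2)) * (-(2 * x / 2)))) x := by
    refine HasDerivAt.const_mul _ (HasDerivAt.exp ?_)
    have := ((hasDerivAt_pow 2 x).div_const 2).fun_neg
    simpa using this
  have h2 := h.ofReal_comp
  have hf : (vacuum : ℝ → ℂ) =
      fun x : ℝ => ((Real.pi ^ (-(1 / 4) : ℝ) * Real.exp (-(x ^ 2 / 2)) : ℝ) : ℂ) :=
    funext vacuum_apply
  rw [hf]
  refine h2.congr_deriv ?_
  push_cast
  ring

/-! ### Hermite functions on the line -/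

/-- The position operator of one mode. -/
def position1 : Module.End ℂ 𝓢(ℝ, ℂ) :=
  (SchwartzMap.smulLeftCLM ℂ (fun x : ℝ => (x : ℂ))).toLinearMap

/-- The derivative of Schwartz functions on the line. -/
def deriv1 : Module.End ℂ 𝓢(ℝ, ℂ) := (SchwartzMap.derivCLM ℂ ℂ).toLinearMap

/-- The annihilation operator of one mode. -/
def annihilation1 : Module.End ℂ 𝓢(ℝ, ℂ) := ((1 / √2 : ℝ) : ℂ) • (position1 + deriv1)

/-- The creation operator of one mode. -/
def creation1 : Module.End ℂ 𝓢(ℝ, ℂ) := ((1 / √2 : ℝ) : ℂ) • (position1 - deriv1)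

theorem position1_apply (f : 𝓢(ℝ, ℂ)) (x : ℝ) : position1 f x = (x : ℂ) * f x := by
  have h : Function.HasTemperateGrowth (fun x : ℝ => (x : ℂ)) :=
    Complex.ofRealCLM.hasTemperateGrowth
  simp [position1, SchwartzMap.smulLeftCLM_apply_apply h]

theorem deriv1_apply (f : 𝓢(ℝ, ℂ)) (x : ℝ) : deriv1 f x = deriv f x := rfl

theorem annihilation1_apply (f : 𝓢(ℝ, ℂ)) (x : ℝ) :
    annihilation1 f x = ((1 / √2 : ℝ) : ℂ) * ((x : ℂ) * f x + deriv f x) := by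
  simp [annihilation1, position1_apply, deriv1_apply, mul_add]

theorem creation1_apply (f : 𝓢(ℝ, ℂ)) (x : ℝ) :
    creation1 f x = ((1 / √2 : ℝ) : ℂ) * ((x : ℂ) * f x - deriv f x) := by
  simp [creation1, position1_apply, deriv1_apply]

theorem inv_sqrt_two_mul_self : ((1 / √2 : ℝ) : ℂ) * ((1 / √2 : ℝ) : ℂ) = 1 / 2 := by
  rw [← Complex.ofReal_mul, div_mul_div_comm, Real.mul_self_sqrt (by norm_num)]
  norm_num

theorem deriv1_mul_position1 : deriv1 * position1 = position1 * deriv1 + 1 := by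
  ext f x
  simp only [Module.End.mul_apply, LinearMap.add_apply, Module.End.one_apply,
    add_apply, deriv1_apply, position1_apply]
  have h : HasDerivAt (position1 f : ℝ → ℂ) (1 * f x + (x : ℂ) * deriv f x) x := by
    have := (Complex.ofRealCLM.hasDerivAt (x := x)).fun_mul (f.hasDerivAt x)
    have he : (position1 f : ℝ → ℂ) = fun y : ℝ => (y : ℂ) * f y := funext (position1_apply f)
    rw [he]
    simpa using this
  rw [h.deriv]
  ring

theorem annihilation1_mul_creation1 :
    annihilation1 * creation1 = creation1 * annihilation1 + 1 := by
  rw [annihilation1, creation1, smul_mul_smul_comm, smul_mul_smul_comm, inv_sqrt_two_mul_self]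
  simp only [add_mul, mul_add, sub_mul, mul_sub, deriv1_mul_position1]
  module

theorem annihilation1_vacuum : annihilation1 vacuum = 0 := by
  ext x
  rw [annihilation1_apply, (hasDerivAt_vacuum x).deriv]
  simp

/-- The normalized Hermite functions. -/
def hermiteFunction : ℕ → 𝓢(ℝ, ℂ)
  | 0 => vacuum
  | n + 1 => (((√(n + 1 : ℝ))⁻¹ : ℝ) : ℂ) • creation1 (hermiteFunction n)

theorem creation1_hermiteFunction (n : ℕ) :
    creation1 (hermiteFunction n) = ((√(n + 1 : ℝ) : ℝ) : ℂ) • hermiteFunction (n + 1) := by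
  rw [hermiteFunction, smul_smul, ← Complex.ofReal_mul, mul_inv_cancel₀ (by positivity)]
  simp

theorem annihilation1_hermiteFunction (n : ℕ) :
    annihilation1 (hermiteFunction n) = ((√(n : ℝ) : ℝ) : ℂ) • hermiteFunction (n - 1) := by
  induction n with
  | zero => simp [hermiteFunction, annihilation1_vacuum]
  | succ n ih =>
    have h : annihilation1 (creation1 (hermiteFunction n)) =
        ((n + 1 : ℝ) : ℂ) • hermiteFunction n := by
      rw [← Module.End.mul_apply, annihilation1_mul_creation1, LinearMap.add_apply,
        Module.End.mul_apply, ih, map_smul, Module.End.one_apply]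
      rcases n with _ | n
      · simp
      · rw [Nat.add_sub_cancel, creation1_hermiteFunction, smul_smul, ← Complex.ofReal_mul]
        rw [Nat.cast_add_one, Real.mul_self_sqrt (by positivity)]
        push_cast
        module
    rw [hermiteFunction, map_smul, h, smul_smul, ← Complex.ofReal_mul, Nat.add_sub_cancel]
    congr 2
    push_cast
    nth_rw 2 [← Real.mul_self_sqrt (show (0 : ℝ) ≤ n + 1 by positivity)]
    rw [inv_mul_cancel_left₀ (by positivity)]

/-! ### Number states of three modes -/

theorem partialDeriv_apply (j : Fin 3) (f : 𝓢(Config, ℂ)) (x : Config) :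
    partialDeriv j f x = lineDeriv ℝ f x (dir j) :=
  SchwartzMap.lineDerivOp_apply (dir j) f x

theorem position_tensorS_zero (f : 𝓢(ℝ, ℂ)) (g : 𝓢(ℝ × ℝ, ℂ)) :
    position 0 (tensorS f g) = tensorS (position1 f) g := by
  ext x; simp [position_apply, tensorS_apply, position1_apply, coord, mul_assoc]

theorem position_tensorS_one (f g h : 𝓢(ℝ, ℂ)) :
    position 1 (tensorS f (tensorS g h)) = tensorS f (tensorS (position1 g) h) := by
  ext x; simp [position_apply, tensorS_apply, position1_apply, coord]; ring

theorem position_tensorS_two (f g h : 𝓢(ℝ, ℂ)) :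
    position 2 (tensorS f (tensorS g h)) = tensorS f (tensorS g (position1 h)) := by
  ext x; simp [position_apply, tensorS_apply, position1_apply, coord]; ring

theorem hasDerivAt_comp_add (f : 𝓢(ℝ, ℂ)) (x : ℝ) :
    HasDerivAt (fun t : ℝ => f (x + t)) (deriv f x) 0 := by
  have h := f.hasDerivAt (x + 0)
  simpa using HasDerivAt.comp_const_add x 0 h

theorem partialDeriv_tensorS_zero (f : 𝓢(ℝ, ℂ)) (g : 𝓢(ℝ × ℝ, ℂ)) :
    partialDeriv 0 (tensorS f g) = tensorS (deriv1 f) g := by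
  ext x
  rw [partialDeriv_apply]
  refine HasLineDerivAt.lineDeriv ?_
  have := (hasDerivAt_comp_add f x.1).mul_const (g x.2)
  have h0 : x.2 + ((0 : ℝ), (0 : ℝ)) = x.2 := add_zero _
  simpa [h0, HasLineDerivAt, tensorS_apply, dir, deriv1_apply] using this

theorem partialDeriv_tensorS_one (f g h : 𝓢(ℝ, ℂ)) :
    partialDeriv 1 (tensorS f (tensorS g h)) = tensorS f (tensorS (deriv1 g) h) := by
  ext x
  rw [partialDeriv_apply]
  refine HasLineDerivAt.lineDeriv ?_
  have := ((hasDerivAt_comp_add g x.2.1).mul_const (h x.2.2)).const_mul (f x.1)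
  simpa [HasLineDerivAt, tensorS_apply, dir, deriv1_apply] using this

theorem partialDeriv_tensorS_two (f g h : 𝓢(ℝ, ℂ)) :
    partialDeriv 2 (tensorS f (tensorS g h)) = tensorS f (tensorS g (deriv1 h)) := by
  ext x
  rw [partialDeriv_apply]
  refine HasLineDerivAt.lineDeriv ?_
  have := ((hasDerivAt_comp_add h x.2.2).const_mul (g x.2.1)).const_mul (f x.1)
  simpa [HasLineDerivAt, tensorS_apply, dir, deriv1_apply] using this

/-- The number state with occupation numbers `i`. -/
def numberState (i : Occ) : 𝓢(Config, ℂ) :=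
  tensorS (hermiteFunction i.1) (tensorS (hermiteFunction i.2.1) (hermiteFunction i.2.2))

theorem creation_numberState (j : Fin 3) (i : Occ) :
    creation j (numberState i) = ((√(num j i + 1 : ℝ) : ℝ) : ℂ) • numberState (up j i) := by
  obtain ⟨n, k, l⟩ := i
  ext x
  fin_cases j
  · have h := congrArg (· x.1) (creation1_hermiteFunction n)
    simp only [creation1_apply, smul_apply, smul_eq_mul] at h
    simp [creation, numberState, up, num, position_tensorS_zero, partialDeriv_tensorS_zero,
      tensorS_apply, position1_apply, deriv1_apply] at h ⊢
    linear_combination (hermiteFunction k x.2.1 * hermiteFunction l x.2.2) * h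
  · have h := congrArg (· x.2.1) (creation1_hermiteFunction k)
    simp only [creation1_apply, smul_apply, smul_eq_mul] at h
    simp [creation, numberState, up, num, position_tensorS_one, partialDeriv_tensorS_one,
      tensorS_apply, position1_apply, deriv1_apply] at h ⊢
    linear_combination (hermiteFunction n x.1 * hermiteFunction l x.2.2) * h
  · have h := congrArg (· x.2.2) (creation1_hermiteFunction l)
    simp only [creation1_apply, smul_apply, smul_eq_mul] at h
    simp [creation, numberState, up, num, position_tensorS_two, partialDeriv_tensorS_two,
      tensorS_apply, position1_apply, deriv1_apply] at h ⊢
    linear_combination (hermiteFunction n x.1 * hermiteFunction k x.2.1) * h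

theorem annihilation_numberState (j : Fin 3) (i : Occ) :
    annihilation j (numberState i) = ((√(num j i : ℝ) : ℝ) : ℂ) • numberState (down j i) := by
  obtain ⟨n, k, l⟩ := i
  ext x
  fin_cases j
  · have h := congrArg (· x.1) (annihilation1_hermiteFunction n)
    simp only [annihilation1_apply, smul_apply, smul_eq_mul] at h
    simp [annihilation, numberState, down, num, position_tensorS_zero, partialDeriv_tensorS_zero,
      tensorS_apply, position1_apply, deriv1_apply] at h ⊢
    linear_combination (hermiteFunction k x.2.1 * hermiteFunction l x.2.2) * h
  · have h := congrArg (· x.2.1) (annihilation1_hermiteFunction k)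
    simp only [annihilation1_apply, smul_apply, smul_eq_mul] at h
    simp [annihilation, numberState, down, num, position_tensorS_one, partialDeriv_tensorS_one,
      tensorS_apply, position1_apply, deriv1_apply] at h ⊢
    linear_combination (hermiteFunction n x.1 * hermiteFunction l x.2.2) * h
  · have h := congrArg (· x.2.2) (annihilation1_hermiteFunction l)
    simp only [annihilation1_apply, smul_apply, smul_eq_mul] at h
    simp [annihilation, numberState, down, num, position_tensorS_two, partialDeriv_tensorS_two,
      tensorS_apply, position1_apply, deriv1_apply] at h ⊢
    linear_combination (hermiteFunction n x.1 * hermiteFunction k x.2.1) * h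

/-! ### Orthonormality of the number states -/

theorem inner_creation (j : Fin 3) (f g : 𝓢(Config, ℂ)) :
    ⟪toL2 (creation j f), toL2 g⟫_ℂ = ⟪toL2 f, toL2 (annihilation j g)⟫_ℂ := by
  rw [← inner_conj_symm, ← inner_ann, inner_conj_symm]

theorem creation_annihilation_numberState (j : Fin 3) (i : Occ) :
    creation j (annihilation j (numberState i)) = (num j i : ℂ) • numberState i := by
  rw [annihilation_numberState, map_smul, creation_numberState, smul_smul, ← Complex.ofReal_mul]
  by_cases h : num j i = 0
  · simp [h]
  · have h1 : ((num j (down j i) : ℝ) + 1) = num j i := by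
      rw [num_down]; exact_mod_cast Nat.succ_pred_eq_of_ne_zero h
    rw [h1, up_down h, Real.mul_self_sqrt (by positivity)]
    simp

theorem annihilation_creation_numberState (j : Fin 3) (i : Occ) :
    annihilation j (creation j (numberState i)) = ((num j i + 1 : ℝ) : ℂ) • numberState i := by
  rw [creation_numberState, map_smul, annihilation_numberState, smul_smul, ← Complex.ofReal_mul,
    down_up, num_up, Nat.cast_add_one, Real.mul_self_sqrt (by positivity)]

/-- The number operator of mode j is symmetric, and eigenvectors of a symmetric operator with
different eigenvalues are orthogonal. -/
theorem inner_numberState_of_num_ne {j : Fin 3} {i i' : Occ} (h : num j i ≠ num j i') :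
    ⟪toL2 (numberState i), toL2 (numberState i')⟫_ℂ = 0 := by
  have h1 : ⟪toL2 (creation j (annihilation j (numberState i))), toL2 (numberState i')⟫_ℂ =
      ⟪toL2 (numberState i), toL2 (creation j (annihilation j (numberState i')))⟫_ℂ := by
    rw [inner_creation, inner_ann]
  rw [creation_annihilation_numberState, creation_annihilation_numberState, toL2_smul, toL2_smul,
    inner_smul_left, inner_smul_right, map_natCast] at h1
  have h2 : ((num j i : ℂ) - num j i') * ⟪toL2 (numberState i), toL2 (numberState i')⟫_ℂ = 0 := by
    rw [sub_mul, h1, sub_self]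
  refine (mul_eq_zero.1 h2).resolve_left ?_
  exact sub_ne_zero.2 (by exact_mod_cast h)

theorem inner_numberState_up (j : Fin 3) (i : Occ) :
    ⟪toL2 (numberState (up j i)), toL2 (numberState (up j i))⟫_ℂ =
      ⟪toL2 (numberState i), toL2 (numberState i)⟫_ℂ := by
  have h1 : ⟪toL2 (creation j (numberState i)), toL2 (creation j (numberState i))⟫_ℂ =
      ((num j i + 1 : ℝ) : ℂ) * ⟪toL2 (numberState i), toL2 (numberState i)⟫_ℂ := by
    rw [inner_creation, annihilation_creation_numberState, toL2_smul, inner_smul_right]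
  rw [creation_numberState, toL2_smul, inner_smul_left, inner_smul_right, Complex.conj_ofReal,
    ← mul_assoc, ← Complex.ofReal_mul, Real.mul_self_sqrt (by positivity)] at h1
  refine mul_left_cancel₀ ?_ h1
  exact_mod_cast (by positivity : (num j i + 1 : ℝ) ≠ 0)

theorem integral_conj_vacuum_mul_vacuum :
    ∫ x, (starRingEnd ℂ) (vacuum x) * vacuum x = 1 := by
  have h : ∀ x : ℝ, (starRingEnd ℂ) (vacuum x) * vacuum x =
      ((Real.pi ^ (-(1 / 2) : ℝ) * Real.exp (-1 * x ^ 2) : ℝ) : ℂ) := by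
    intro x
    rw [vacuum_apply, Complex.conj_ofReal, ← Complex.ofReal_mul]
    congr 1
    rw [mul_mul_mul_comm, ← Real.rpow_add Real.pi_pos, ← Real.exp_add]
    congr 2 <;> ring
  simp only [h]
  rw [integral_complex_ofReal, integral_const_mul, integral_gaussian, div_one,
    Real.sqrt_eq_rpow, ← Real.rpow_add Real.pi_pos]
  norm_num

theorem inner_numberState_zero :
    ⟪toL2 (numberState (0, 0, 0)), toL2 (numberState (0, 0, 0))⟫_ℂ = 1 := by
  rw [inner_toL2]
  have h : ∀ x : Config, (starRingEnd ℂ) (numberState (0, 0, 0) x) * numberState (0, 0, 0) x =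
      ((starRingEnd ℂ) (vacuum x.1) * vacuum x.1) *
      ((fun y : ℝ × ℝ => ((starRingEnd ℂ) (vacuum y.1) * vacuum y.1) *
        ((starRingEnd ℂ) (vacuum y.2) * vacuum y.2)) x.2) := by
    intro x
    simp only [numberState, tensorS_apply, hermiteFunction, map_mul]
    ring
  simp only [h]
  rw [Measure.volume_eq_prod,
    integral_prod_mul (fun t => (starRingEnd ℂ) (vacuum t) * vacuum t)
      (fun y : ℝ × ℝ => ((starRingEnd ℂ) (vacuum y.1) * vacuum y.1) *
        ((starRingEnd ℂ) (vacuum y.2) * vacuum y.2)), Measure.volume_eq_prod,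
    integral_prod_mul (fun t => (starRingEnd ℂ) (vacuum t) * vacuum t)
      (fun t => (starRingEnd ℂ) (vacuum t) * vacuum t), integral_conj_vacuum_mul_vacuum]
  norm_num

theorem inner_numberState_self (i : Occ) :
    ⟪toL2 (numberState i), toL2 (numberState i)⟫_ℂ = 1 := by
  obtain ⟨n, k, l⟩ := i
  induction n with
  | succ n ih => exact (inner_numberState_up 0 (n, k, l)).trans ih
  | zero =>
    induction k with
    | succ k ih => exact (inner_numberState_up 1 (0, k, l)).trans ih
    | zero =>
      induction l with
      | succ l ih => exact (inner_numberState_up 2 (0, 0, l)).trans ih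
      | zero => exact inner_numberState_zero

theorem orthonormal_numberState : Orthonormal ℂ fun i => toL2 (numberState i) := by
  refine ⟨fun i => ?_, fun i i' h => ?_⟩
  · rw [norm_eq_sqrt_re_inner (𝕜 := ℂ), inner_numberState_self]
    simp
  · by_contra hne
    apply h
    have := fun j : Fin 3 =>
      not_imp_comm.1 (inner_numberState_of_num_ne (j := j) (i := i) (i' := i')) hne
    exact Prod.ext (this 0) (Prod.ext (this 1) (this 2))

/-! ### Uniqueness for Fourier transforms of integrable functions -/

section Uniqueness

variable {X : Type*} [NormedAddCommGroup X] [NormedSpace ℝ X] [MeasurableSpace X] [BorelSpace X]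
  [SecondCountableTopology X] [CompleteSpace X] {μ : Measure X}

/-- The positive and negative parts of g are densities of finite measures with equal characteristic
functions. The measures coincide, hence so do the two parts almost everywhere, which forces g = 0.
-/
theorem ae_eq_zero_of_forall_integral_exp_real {g : X → ℝ} (hg : Integrable g μ)
    (h : ∀ L : StrongDual ℝ X, ∫ x, Complex.exp (L x * Complex.I) * g x ∂μ = 0) : g =ᵐ[μ] 0 := by
  have hchar : ∀ {f : X → ℝ}, Integrable f μ → ∀ L : StrongDual ℝ X,
      charFunDual (μ.withDensity fun x => ENNReal.ofReal (f x)) L =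
      ∫ x, Complex.exp (L x * Complex.I) * ((max (f x) 0 : ℝ) : ℂ) ∂μ := by
    intro f hf L
    rw [charFunDual_apply, integral_withDensity_eq_integral_toReal_smul₀
      hf.1.aemeasurable.ennreal_ofReal (Filter.Eventually.of_forall fun _ => ENNReal.ofReal_lt_top)]
    refine integral_congr_ae (Filter.Eventually.of_forall fun x => ?_)
    simp only [ENNReal.toReal_ofReal', Complex.real_smul]
    rw [mul_comm]
  have hint : ∀ {f : X → ℝ}, Integrable f μ → ∀ L : StrongDual ℝ X,
      Integrable (fun x => Complex.exp (L x * Complex.I) * ((max (f x) 0 : ℝ) : ℂ)) μ := by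
    intro f hf L
    refine (hf.pos_part.ofReal (𝕜 := ℂ)).bdd_mul (c := 1) (by fun_prop) ?_
    exact Filter.Eventually.of_forall fun x => by rw [Complex.norm_exp_ofReal_mul_I]
  have := isFiniteMeasure_withDensity_ofReal (μ := μ) hg.2
  have := isFiniteMeasure_withDensity_ofReal (μ := μ) hg.neg.2
  have heq : (μ.withDensity fun x => ENNReal.ofReal (g x)) =
      μ.withDensity fun x => ENNReal.ofReal ((-g) x) := by
    refine Measure.ext_of_charFunDual (funext fun L => ?_)
    rw [hchar hg, hchar hg.neg, ← sub_eq_zero, ← integral_sub (hint hg L) (hint hg.neg L), ← h L]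
    refine integral_congr_ae (Filter.Eventually.of_forall fun x => ?_)
    simp only
    rw [← mul_sub, ← Complex.ofReal_sub]
    congr 2
    simp only [Pi.neg_apply]
    rcases le_total (g x) 0 with h0 | h0
    · rw [max_eq_right h0, max_eq_left (by linarith)]; ring
    · rw [max_eq_left h0, max_eq_right (by linarith)]; ring
  rw [withDensity_eq_iff hg.1.aemeasurable.ennreal_ofReal hg.neg.1.aemeasurable.ennreal_ofReal
    hg.lintegral_lt_top.ne] at heq
  filter_upwards [heq] with x hx
  simp only [Pi.neg_apply] at hx
  rcases lt_trichotomy (g x) 0 with h0 | h0 | h0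
  · rw [ENNReal.ofReal_of_nonpos h0.le, eq_comm, ENNReal.ofReal_eq_zero] at hx
    exact absurd hx (by linarith)
  · exact h0
  · rw [ENNReal.ofReal_of_nonpos (by linarith : -g x ≤ 0), ENNReal.ofReal_eq_zero] at hx
    exact absurd hx (by linarith)

theorem ae_eq_zero_of_forall_integral_exp {g : X → ℂ} (hg : Integrable g μ)
    (h : ∀ L : StrongDual ℝ X, ∫ x, Complex.exp (L x * Complex.I) * g x ∂μ = 0) : g =ᵐ[μ] 0 := by
  have hint : ∀ {f : X → ℂ}, Integrable f μ → ∀ L : StrongDual ℝ X,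
      Integrable (fun x => Complex.exp (L x * Complex.I) * f x) μ := by
    intro f hf L
    refine hf.bdd_mul (c := 1) (by fun_prop) ?_
    exact Filter.Eventually.of_forall fun x => by rw [Complex.norm_exp_ofReal_mul_I]
  -- Conjugating the hypothesis at -L gives it for the conjugate of g, hence for the real and
  -- imaginary parts.
  have hconj : ∀ L : StrongDual ℝ X,
      ∫ x, Complex.exp (L x * Complex.I) * (starRingEnd ℂ) (g x) ∂μ = 0 := by
    intro L
    have h1 := congrArg (starRingEnd ℂ) (h (-L))
    rw [← integral_conj, map_zero] at h1
    rw [← h1]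
    refine integral_congr_ae (Filter.Eventually.of_forall fun x => ?_)
    simp [← Complex.exp_conj]
  have hgc : Integrable (fun x => (starRingEnd ℂ) (g x)) μ :=
    (Complex.conjCLE : ℂ →L[ℝ] ℂ).integrable_comp hg
  have hre := ae_eq_zero_of_forall_integral_exp_real hg.re (fun L => by
    have h1 := integral_add (hint hg L) (hint hgc L)
    rw [h, hconj, add_zero] at h1
    rw [← mul_right_inj' (two_ne_zero (α := ℂ)), mul_zero, ← h1, ← integral_const_mul]
    refine integral_congr_ae (Filter.Eventually.of_forall fun x => ?_)
    simp only [RCLike.re_eq_complex_re]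
    rw [Complex.re_eq_add_conj]; ring)
  have him := ae_eq_zero_of_forall_integral_exp_real hg.im (fun L => by
    have h1 := integral_sub (hint hg L) (hint hgc L)
    rw [h, hconj, sub_zero] at h1
    rw [← mul_right_inj' (mul_ne_zero (two_ne_zero (α := ℂ)) Complex.I_ne_zero), mul_zero, ← h1,
      ← integral_const_mul]
    refine integral_congr_ae (Filter.Eventually.of_forall fun x => ?_)
    simp only [RCLike.im_eq_complex_im]
    rw [Complex.im_eq_sub_conj]
    field_simp)
  filter_upwards [hre, him] with x h1 h2
  exact Complex.ext h1 h2

end Uniqueness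

/-! ### Completeness of the number states -/

theorem inner_toL2_left (f : 𝓢(Config, ℂ)) (u : L2 Config) :
    ⟪toL2 f, u⟫_ℂ = ∫ x, (starRingEnd ℂ) (f x) * u x := by
  rw [L2.inner_def]
  refine integral_congr_ae ?_
  filter_upwards [SchwartzMap.coeFn_toLp f 2 (volume : Measure Config)] with x hx
  rw [toL2, hx, RCLike.inner_apply, mul_comm]

theorem position_eq (j : Fin 3) :
    position j = ((√2 / 2 : ℝ) : ℂ) • (annihilation j + creation j) := by
  have h2 : ((√2 / 2 : ℝ) : ℂ) * ((1 / √2 : ℝ) : ℂ) = 1 / 2 := by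
    rw [← Complex.ofReal_mul, div_mul_div_comm, mul_one, mul_comm, ← div_div,
      div_self (by positivity)]
    norm_num
  rw [annihilation, creation, ← smul_add, smul_smul, h2]
  module

theorem position_mem_span (j : Fin 3) {f : 𝓢(Config, ℂ)}
    (hf : f ∈ Submodule.span ℂ (Set.range numberState)) :
    position j f ∈ Submodule.span ℂ (Set.range numberState) := by
  induction hf using Submodule.span_induction with
  | zero => simp
  | add f g _ _ hf hg => rw [map_add]; exact add_mem hf hg
  | smul c f _ hf => rw [map_smul]; exact Submodule.smul_mem _ _ hf
  | mem f hf =>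
    obtain ⟨i, rfl⟩ := hf
    rw [position_eq, LinearMap.smul_apply, LinearMap.add_apply, annihilation_numberState,
      creation_numberState]
    exact Submodule.smul_mem _ _ (add_mem
      (Submodule.smul_mem _ _ (Submodule.subset_span ⟨_, rfl⟩))
      (Submodule.smul_mem _ _ (Submodule.subset_span ⟨_, rfl⟩)))

theorem dual_apply (L : StrongDual ℝ Config) (x : Config) :
    L x = ∑ j, L (dir j) * coord j x := by
  have hx : x = x.1 • dir 0 + x.2.1 • dir 1 + x.2.2 • dir 2 := by simp [dir]
  conv_lhs => rw [hx]
  simp [Fin.sum_univ_three, coord, mul_comm]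

theorem dual_pow_mul_mem_span (L : StrongDual ℝ Config) {f : 𝓢(Config, ℂ)}
    (hf : f ∈ Submodule.span ℂ (Set.range numberState)) (k : ℕ) :
    ∃ g ∈ Submodule.span ℂ (Set.range numberState), ∀ x, g x = (L x : ℂ) ^ k * f x := by
  induction k with
  | zero => exact ⟨f, hf, fun x => by simp⟩
  | succ k ih =>
    obtain ⟨g, hg, hgx⟩ := ih
    refine ⟨∑ j, (L (dir j) : ℂ) • position j g,
      Submodule.sum_mem _ fun j _ => Submodule.smul_mem _ _ (position_mem_span j hg), fun x => ?_⟩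
    have hL : (L x : ℂ) = ∑ j, (L (dir j) : ℂ) * coord j x := by
      rw [dual_apply]; push_cast; rfl
    simp only [Fin.sum_univ_three, add_apply, smul_apply, smul_eq_mul, position_apply, hgx] at hL ⊢
    linear_combination (-(L x : ℂ) ^ k * f x) * hL

theorem numberState_zero_apply (x : Config) : numberState (0, 0, 0) x =
    (((Real.pi ^ (-(1 / 4) : ℝ)) ^ 3 *
      Real.exp (-((x.1 ^ 2 + x.2.1 ^ 2 + x.2.2 ^ 2) / 2)) : ℝ) : ℂ) := by
  simp only [numberState, tensorS_apply, hermiteFunction, vacuum_apply, ← Complex.ofReal_mul]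
  congr 1
  rw [show -((x.1 ^ 2 + x.2.1 ^ 2 + x.2.2 ^ 2) / 2) =
    -(x.1 ^ 2 / 2) + (-(x.2.1 ^ 2 / 2) + -(x.2.2 ^ 2 / 2)) by ring, Real.exp_add, Real.exp_add]
  ring

theorem memLp_exp_mul_numberState_zero (L : StrongDual ℝ Config) :
    MemLp (fun x : Config => (Real.exp (L x) : ℂ) * numberState (0, 0, 0) x) 2 volume := by
  -- Completing the square: L x - |x|²/2 = |a|²/2 - |x - a|²/2 with a the gradient of L, so the
  -- function is a multiple of a translated Gaussian.
  set a : Config := (L (dir 0), L (dir 1), L (dir 2)) with ha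
  set s : ℝ := (a.1 ^ 2 + a.2.1 ^ 2 + a.2.2 ^ 2) / 2 with hs
  have h := (((Real.exp s : ℝ) : ℂ) •
    SchwartzMap.compSubConstCLM ℂ a (numberState (0, 0, 0))).memLp 2 (volume : Measure Config)
  convert h using 1
  ext x
  simp only [smul_apply, SchwartzMap.compSubConstCLM_apply, numberState_zero_apply, smul_eq_mul,
    ← Complex.ofReal_mul]
  congr 1
  rw [mul_left_comm, ← Real.exp_add, mul_left_comm, ← Real.exp_add]
  congr 2
  rw [dual_apply, hs]
  simp [Fin.sum_univ_three, coord, ha]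
  ring

/-- The span of the number states is stable under multiplication by coordinates, so F, the vacuum
times u, has vanishing moments against all powers of linear forms L. As exp |L| F is integrable, the
exponential series may be integrated termwise and the Fourier transform of F vanishes. Thus F = 0,
and the vacuum has no zeros. -/
theorem eq_zero_of_inner_numberState {u : L2 Config}
    (hu : ∀ i, ⟪toL2 (numberState i), u⟫_ℂ = 0) : u = 0 := by
  have hspan : ∀ f ∈ Submodule.span ℂ (Set.range numberState), ⟪toL2 f, u⟫_ℂ = 0 := by
    intro f hf
    induction hf using Submodule.span_induction with
    | zero => rw [← zero_smul ℂ (0 : 𝓢(Config, ℂ)), toL2_smul, zero_smul, inner_zero_left]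
    | add f g _ _ hf hg => rw [toL2_add, inner_add_left, hf, hg, add_zero]
    | smul c f _ hf => rw [toL2_smul, inner_smul_left, hf, mul_zero]
    | mem f hf => obtain ⟨i, rfl⟩ := hf; exact hu i
  set F : Config → ℂ := fun x => numberState (0, 0, 0) x * u x with hF
  have hFint : Integrable F :=
    MemLp.integrable_mul ((numberState (0, 0, 0)).memLp 2 (volume : Measure Config)) (Lp.memLp u)
  have hmom : ∀ (L : StrongDual ℝ Config) (k : ℕ), ∫ x, (L x : ℂ) ^ k * F x = 0 := by
    intro L k
    obtain ⟨g, hg, hgx⟩ := dual_pow_mul_mem_span L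
      (Submodule.subset_span ⟨((0, 0, 0) : Occ), rfl⟩) k
    rw [← hspan g hg, inner_toL2_left]
    refine integral_congr_ae (Filter.Eventually.of_forall fun x => ?_)
    simp only [hF, hgx, map_mul, map_pow, Complex.conj_ofReal, numberState_zero_apply]
    ring
  have hexp : ∀ L : StrongDual ℝ Config,
      Integrable fun x => Real.exp (L x) * ‖F x‖ := by
    intro L
    have h := (MemLp.integrable_mul (memLp_exp_mul_numberState_zero L) (Lp.memLp u)).norm
    refine h.congr (Filter.Eventually.of_forall fun x => ?_)
    simp [hF, mul_assoc, Complex.norm_real, -Complex.ofReal_exp]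
  have habs : ∀ L : StrongDual ℝ Config, Integrable fun x => Real.exp |L x| * ‖F x‖ := by
    intro L
    refine ((hexp L).add (hexp (-L))).mono' ?_ (Filter.Eventually.of_forall fun x => ?_)
    · exact AEStronglyMeasurable.mul (by fun_prop) hFint.1.norm
    · rw [Real.norm_of_nonneg (by positivity), Pi.add_apply, ← add_mul]
      gcongr
      exact Real.exp_abs_le (L x)
  have hchar : ∀ L : StrongDual ℝ Config, ∫ x, Complex.exp (L x * Complex.I) * F x = 0 := by
    intro L
    have hs : ∀ x, HasSum (fun k : ℕ => |L x| ^ k / k.factorial * ‖F x‖)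
        (Real.exp |L x| * ‖F x‖) := fun x => by
      have := (NormedSpace.expSeries_div_hasSum_exp (|L x|)).mul_right ‖F x‖
      rwa [← Real.exp_eq_exp_ℝ] at this
    have h := hasSum_integral_of_dominated_convergence (μ := (volume : Measure Config))
      (F := fun (k : ℕ) x => (L x * Complex.I) ^ k / (k.factorial : ℂ) * F x)
      (f := fun x => Complex.exp (L x * Complex.I) * F x)
      (fun k x => |L x| ^ k / k.factorial * ‖F x‖) ?_ ?_ ?_ ?_ ?_
    · have h0 : ∀ k : ℕ, ∫ x, (L x * Complex.I) ^ k / (k.factorial : ℂ) * F x = 0 := by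
        intro k
        have : ∀ x, (L x * Complex.I) ^ k / (k.factorial : ℂ) * F x =
            (Complex.I ^ k / (k.factorial : ℂ)) * ((L x : ℂ) ^ k * F x) := fun x => by ring
        simp only [this]
        rw [integral_const_mul, hmom, mul_zero]
      simp only [h0] at h
      exact h.unique hasSum_zero
    · intro k
      exact AEStronglyMeasurable.mul (by fun_prop) hFint.1
    · intro k
      refine Filter.Eventually.of_forall fun x => ?_
      simp
    · exact Filter.Eventually.of_forall fun x => (hs x).summable
    · refine (habs L).congr (Filter.Eventually.of_forall fun x => ?_)
      exact (hs x).tsum_eq.symm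
    · refine Filter.Eventually.of_forall fun x => ?_
      have := (NormedSpace.expSeries_div_hasSum_exp (L x * Complex.I)).mul_right (F x)
      rwa [← Complex.exp_eq_exp_ℂ] at this
  have hF0 := ae_eq_zero_of_forall_integral_exp hFint hchar
  rw [Lp.eq_zero_iff_ae_eq_zero]
  filter_upwards [hF0] with x hx
  refine (mul_eq_zero.1 hx).resolve_left ?_
  rw [numberState_zero_apply]
  exact Complex.ofReal_ne_zero.2 (by positivity)

/-- The number states form a Hilbert basis. -/
def numberBasis : HilbertBasis Occ ℂ (L2 Config) :=
  HilbertBasis.mkOfOrthogonalEqBot orthonormal_numberState <| by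
    rw [Submodule.eq_bot_iff]
    intro u hu
    refine eq_zero_of_inner_numberState fun i => ?_
    exact (Submodule.mem_orthogonal _ _).1 hu _ (Submodule.subset_span ⟨i, rfl⟩)

theorem numberBasis_apply (i : Occ) : numberBasis i = toL2 (numberState i) := by
  simp [numberBasis]

/-! ### Expectation values in terms of number states -/

theorem W_numberState (i : Occ) : W (numberState i) =
    ((√(num 0 i + 1 : ℝ) : ℝ) : ℂ) • numberState (up 0 i) +
      (((√(num 1 i : ℝ) : ℝ) : ℂ) • numberState (down 1 i) +
        ((√(num 2 i : ℝ) : ℝ) : ℂ) • numberState (down 2 i)) := by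
  simp only [W, LinearMap.add_apply, creation_numberState, annihilation_numberState, add_assoc]

section

variable {E : Type*} [NormedAddCommGroup E] [InnerProductSpace ℂ E]

theorem ladder_apply (v : Occ → E) (i : Occ) : ladder v i =
    ((√(num 0 i + 1 : ℝ) : ℝ) : ℂ) • v (up 0 i) +
      (((√(num 1 i : ℝ) : ℝ) : ℂ) • v (down 1 i) +
        ((√(num 2 i : ℝ) : ℝ) : ℂ) • v (down 2 i)) := rfl

variable {σ : L2 Config →L[ℂ] L2 Config} {Ψ : Occ → E}

/-- Each W maps a number state to a finite combination of number states, so this is algebra in the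
Gram matrix. The innermost W acts on the index first and becomes the outermost `ladder`, whence the
two different forms of the power rule. -/
theorem inner_W_pow_numberState (hΨ : ∀ i i',
      ⟪toL2 (numberState i), σ (toL2 (numberState i'))⟫_ℂ = ⟪Ψ i, Ψ i'⟫_ℂ) (p q : ℕ) (i i' : Occ) :
    ⟪toL2 ((W ^ p) (numberState i)), σ (toL2 ((W ^ q) (numberState i')))⟫_ℂ =
      ⟪(ladder ^ p) Ψ i, (ladder ^ q) Ψ i'⟫_ℂ := by
  induction p generalizing i with
  | zero =>
    induction q generalizing i' with
    | zero => exact hΨ i i'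
    | succ q ih =>
      rw [pow_succ W, Module.End.mul_apply, W_numberState, pow_succ' ladder q,
        Module.End.mul_apply ladder, ladder_apply]
      simp only [map_add, map_smul, toL2_add, toL2_smul, inner_add_right, inner_smul_right, ih]
  | succ p ih =>
    rw [pow_succ W, Module.End.mul_apply, W_numberState, pow_succ' ladder p,
      Module.End.mul_apply ladder, ladder_apply]
    simp only [map_add, map_smul, toL2_add, toL2_smul, inner_add_left, inner_smul_left, ih]

theorem re_inner_W_pow_numberState (hΨ : ∀ i i',
      ⟪toL2 (numberState i), σ (toL2 (numberState i'))⟫_ℂ = ⟪Ψ i, Ψ i'⟫_ℂ) (m : ℕ) (i : Occ) :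
    RCLike.re ⟪toL2 ((W ^ m) (numberState i)), σ (toL2 ((W ^ m) (numberState i)))⟫_ℂ =
      ‖(ladder ^ m) Ψ i‖ ^ 2 := by
  rw [inner_W_pow_numberState hΨ, inner_self_eq_norm_sq]

theorem norm_numberState (i : Occ) : ‖toL2 (numberState i)‖ = 1 := orthonormal_numberState.1 i

theorem norm_le_of_gram (hΨ : ∀ i i',
      ⟪toL2 (numberState i), σ (toL2 (numberState i'))⟫_ℂ = ⟪Ψ i, Ψ i'⟫_ℂ) (i : Occ) :
    ‖Ψ i‖ ≤ √‖σ‖ := by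
  refine Real.le_sqrt_of_sq_le ?_
  rw [← inner_self_eq_norm_sq (𝕜 := ℂ), ← hΨ]
  refine (RCLike.re_le_norm _).trans ((norm_inner_le_norm _ _).trans ?_)
  rw [norm_numberState, one_mul]
  simpa [norm_numberState] using σ.le_opNorm (toL2 (numberState i))

end

/-- Every finite set of number states competes in the supremum. Only this inequality is needed,
because the trace is to be bounded from below. -/
theorem tsum_le_expectMulAdjoint (K : Module.End ℂ 𝓢(Config, ℂ)) (ρ : L2 Config →L[ℂ] L2 Config) :
    ∑' i, ENNReal.ofReal (RCLike.re
      ⟪toL2 (K (numberState i)), ρ (toL2 (K (numberState i)))⟫_ℂ) ≤ expectMulAdjoint K ρ := by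
  rw [ENNReal.tsum_eq_iSup_sum]
  refine iSup_le fun F => ?_
  let e := F.equivFin.symm
  refine le_iSup_of_le F.card (le_iSup_of_le (fun a => numberState (e a)) (le_iSup_of_le ?_ ?_))
  · exact orthonormal_numberState.comp (fun a => ((e a : F) : Occ))
      (Subtype.val_injective.comp e.injective)
  · rw [← Finset.sum_coe_sort, ← Equiv.sum_comp e]

theorem tsum_ofReal_re_inner_numberState {ρ : L2 Config →L[ℂ] L2 Config}
    (hρ : IsDensityOperator ρ) : ∑' i, ENNReal.ofReal (RCLike.re
      ⟪toL2 (numberState i), ρ (toL2 (numberState i))⟫_ℂ) = 1 := by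
  have h := Complex.hasSum_re (hρ.trace_eq_one Occ numberBasis)
  simp only [numberBasis_apply, Complex.one_re] at h
  have hn : ∀ i, 0 ≤ (⟪toL2 (numberState i), ρ (toL2 (numberState i))⟫_ℂ).re := fun i =>
    hρ.isPositive.re_inner_nonneg_right _
  simp only [RCLike.re_eq_complex_re]
  rw [← ENNReal.ofReal_tsum_of_nonneg hn h.summable, h.tsum_eq, ENNReal.ofReal_one]

theorem exists_sqrt {H : Type*} [NormedAddCommGroup H] [InnerProductSpace ℂ H] [CompleteSpace H]
    {ρ : H →L[ℂ] H} (h : ρ.IsPositive) :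
    ∃ R : H →L[ℂ] H, ∀ x y : H, ⟪x, ρ y⟫_ℂ = ⟪R x, R y⟫_ℂ := by
  have h0 : 0 ≤ ρ := (ContinuousLinearMap.nonneg_iff_isPositive ρ).2 h
  have h1 : (CFC.sqrt ρ).IsPositive :=
    (ContinuousLinearMap.nonneg_iff_isPositive _).1 (CFC.sqrt_nonneg ρ)
  refine ⟨CFC.sqrt ρ, fun x y => ?_⟩
  conv_lhs => rw [← CFC.sqrt_mul_sqrt_self ρ h0]
  exact (h1.isSelfAdjoint.isSymmetric x _).symm

theorem factorial_le_expect {ρ : L2 Config →L[ℂ] L2 Config} (hρ : IsDensityOperator ρ) (m : ℕ) :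
    (m.factorial : ℝ≥0∞) ≤ expectMulAdjoint (W ^ m) ρ := by
  obtain ⟨R, hR⟩ := exists_sqrt hρ.isPositive
  have hΨ : ∀ i i', ⟪toL2 (numberState i), ρ (toL2 (numberState i'))⟫_ℂ =
      ⟪R (toL2 (numberState i)), R (toL2 (numberState i'))⟫_ℂ := fun i i' => hR _ _
  refine le_trans ?_ (tsum_le_expectMulAdjoint (W ^ m) ρ)
  have h := tsum_ladder_ge (norm_le_of_gram hΨ) m
  simp only [← re_inner_W_pow_numberState hΨ] at h
  have h0 := tsum_ofReal_re_inner_numberState hρ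
  have hre : ∀ i, ‖R (toL2 (numberState i))‖ ^ 2 =
      RCLike.re ⟪toL2 (numberState i), ρ (toL2 (numberState i))⟫_ℂ := fun i => by
    rw [hΨ, inner_self_eq_norm_sq]
  simp only [hre] at h
  rwa [h0, mul_one] at h

/-! ### Separable states -/

section TensorL2

variable {X Y : Type} [MeasureSpace X] [MeasureSpace Y] [SFinite (volume : Measure X)]
  [SFinite (volume : Measure Y)]

theorem inner_tensor (f f' : L2 X) (g g' : L2 Y) :
    ⟪tensor f g, tensor f' g'⟫_ℂ = ⟪f, f'⟫_ℂ * ⟪g, g'⟫_ℂ := by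
  rw [L2.inner_def, L2.inner_def, L2.inner_def, ← integral_prod_mul, ← Measure.volume_eq_prod]
  refine integral_congr_ae ?_
  filter_upwards [(memLp_tensor f g).coeFn_toLp, (memLp_tensor f' g').coeFn_toLp] with x h h'
  rw [tensor, tensor, h, h']
  simp only [RCLike.inner_apply, map_mul]
  ring

end TensorL2

theorem inner_star_star {X : Type} [MeasureSpace X] (f g : L2 X) :
    ⟪star f, star g⟫_ℂ = ⟪g, f⟫_ℂ := by
  rw [L2.inner_def, L2.inner_def]
  refine integral_congr_ae ?_
  filter_upwards [Lp.coeFn_star f, Lp.coeFn_star g] with x h h'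
  rw [h, h']
  simp [RCLike.inner_apply, mul_comm]

/-- The Hermite functions as vectors of `L²(ℝ)`. -/
def hermiteL2 (n : ℕ) : L2 ℝ := (hermiteFunction n).toLp 2

theorem toL2_numberState (i : Occ) : toL2 (numberState i) =
    tensor (hermiteL2 i.1) (tensor (hermiteL2 i.2.1) (hermiteL2 i.2.2)) := by
  have h : ∀ n, hermiteL2 n =ᵐ[volume] hermiteFunction n := fun n =>
    SchwartzMap.coeFn_toLp (hermiteFunction n) 2 (volume : Measure ℝ)
  have h2 : (tensor (hermiteL2 i.2.1) (hermiteL2 i.2.2) : ℝ × ℝ → ℂ) =ᵐ[volume]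
      fun y => hermiteFunction i.2.1 y.1 * hermiteFunction i.2.2 y.2 := by
    filter_upwards [(memLp_tensor (hermiteL2 i.2.1) (hermiteL2 i.2.2)).coeFn_toLp,
      Measure.quasiMeasurePreserving_fst.ae (h i.2.1),
      Measure.quasiMeasurePreserving_snd.ae (h i.2.2)] with y h1 h2 h3
    rw [tensor, h1, h2, h3]
  refine Lp.ext ?_
  filter_upwards [SchwartzMap.coeFn_toLp (numberState i) 2 (volume : Measure Config),
    (memLp_tensor (hermiteL2 i.1) (tensor (hermiteL2 i.2.1) (hermiteL2 i.2.2))).coeFn_toLp,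
    Measure.quasiMeasurePreserving_fst.ae (h i.1),
    Measure.quasiMeasurePreserving_snd.ae h2] with x h1 h3 h4 h5
  rw [toL2, h1, tensor, h3, h4, h5]
  rfl

/-- Square roots of the factors give a Gram family of product vectors u_n ⊗ w_k. Conjugating u_n
reverses the inner products of the first factor (`inner_star_star`), which is exactly the partial
transpose. -/
theorem tsum_ladder_ge_of_isTensorProduct {σ : L2 Config →L[ℂ] L2 Config} {S : L2 ℝ →L[ℂ] L2 ℝ}
    {T : L2 (ℝ × ℝ) →L[ℂ] L2 (ℝ × ℝ)} (hS : S.IsPositive) (hT : T.IsPositive)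
    (hσ : IsTensorProduct σ S T) :
    ∃ Ψ : Occ → L2 Config, (∀ i i',
      ⟪toL2 (numberState i), σ (toL2 (numberState i'))⟫_ℂ = ⟪Ψ i, Ψ i'⟫_ℂ) ∧
      ∀ m : ℕ, (m.factorial * 2 ^ m : ℝ≥0∞) * ∑' i, ENNReal.ofReal (‖Ψ i‖ ^ 2) ≤
        ∑' i, ENNReal.ofReal (‖(ladder ^ m) Ψ i‖ ^ 2) := by
  obtain ⟨Q, hQ⟩ := exists_sqrt hS
  obtain ⟨R, hR⟩ := exists_sqrt hT
  let u : ℕ → L2 ℝ := fun n => Q (hermiteL2 n)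
  let w : ℕ × ℕ → L2 (ℝ × ℝ) := fun k => R (tensor (hermiteL2 k.1) (hermiteL2 k.2))
  have hΨ : ∀ i i', ⟪toL2 (numberState i), σ (toL2 (numberState i'))⟫_ℂ =
      ⟪tensor (u i.1) (w i.2), tensor (u i'.1) (w i'.2)⟫_ℂ := by
    intro i i'
    rw [toL2_numberState, toL2_numberState, hσ, inner_tensor, hQ, hR,
      inner_tensor]
  refine ⟨fun i => tensor (u i.1) (w i.2), hΨ, fun m => ?_⟩
  refine tsum_ladder_ge_of_isTranspose (Φ := fun i => tensor (star (u i.1)) (w i.2))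
    (norm_le_of_gram hΨ) ?_ m
  intro n n' k k'
  rw [inner_tensor, inner_tensor, inner_star_star]

theorem factorial_mul_two_pow_le_expect {ρ : L2 Config →L[ℂ] L2 Config} (hρ : IsDensityOperator ρ)
    (hsep : IsSeparable1_23 ρ) (m : ℕ) :
    (m.factorial * 2 ^ m : ℝ≥0∞) ≤ expectMulAdjoint (W ^ m) ρ := by
  obtain ⟨p, ρa, ρbc, σ, hp, -, ha, hbc, hσ, hsum⟩ := hsep
  choose Ψ hΨ hbound using fun j =>
    tsum_ladder_ge_of_isTensorProduct (ha j).isPositive (hbc j).isPositive (hσ j)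
  have hmix : ∀ (m : ℕ) (i : Occ), ENNReal.ofReal (RCLike.re
      ⟪toL2 ((W ^ m) (numberState i)), ρ (toL2 ((W ^ m) (numberState i)))⟫_ℂ) =
      ∑' j, ENNReal.ofReal (p j) * ENNReal.ofReal (‖(ladder ^ m) (Ψ j) i‖ ^ 2) := by
    intro m i
    set x := toL2 ((W ^ m) (numberState i)) with hx
    have h1 := (innerSL ℂ x).hasSum ((ContinuousLinearMap.apply ℂ (L2 Config) x).hasSum hsum)
    have h2 := Complex.hasSum_re h1
    have h3 : ∀ j, ((innerSL ℂ x) ((ContinuousLinearMap.apply ℂ (L2 Config) x)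
        ((p j : ℂ) • σ j))).re = p j * ‖(ladder ^ m) (Ψ j) i‖ ^ 2 := by
      intro j
      rw [← re_inner_W_pow_numberState (hΨ j)]
      simp [hx]
    simp only [h3] at h2
    simp only [← ENNReal.ofReal_mul (hp _)]
    rw [← ENNReal.ofReal_tsum_of_nonneg (fun j => mul_nonneg (hp j) (sq_nonneg _)) h2.summable,
      h2.tsum_eq]
    rfl
  refine le_trans ?_ (tsum_le_expectMulAdjoint (W ^ m) ρ)
  have h0 := tsum_ofReal_re_inner_numberState hρ
  -- The case m = 0 is the trace of ρ: the weighted squared norms of all the families Ψ_j sum to 1.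
  -- This normalizes the weighted sum of the bounds for the components.
  have hmix0 := hmix 0
  simp only [pow_zero, Module.End.one_apply] at hmix0
  simp only [hmix0] at h0
  rw [ENNReal.tsum_comm] at h0
  simp only [hmix]
  rw [ENNReal.tsum_comm]
  calc (m.factorial * 2 ^ m : ℝ≥0∞)
      = ∑' j, ENNReal.ofReal (p j) * ((m.factorial * 2 ^ m : ℝ≥0∞) *
          ∑' i, ENNReal.ofReal (‖Ψ j i‖ ^ 2)) := by
        conv_lhs => rw [← mul_one (m.factorial * 2 ^ m : ℝ≥0∞), ← h0, ← ENNReal.tsum_mul_left]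
        refine tsum_congr fun j => ?_
        rw [ENNReal.tsum_mul_left, mul_left_comm]
    _ ≤ _ := by
        refine ENNReal.tsum_le_tsum fun j => ?_
        rw [ENNReal.tsum_mul_left]
        gcongr
        exact hbound j m

/-! ### The Gaussian state -/

theorem isDensityOperator_pureState {H : Type*} [NormedAddCommGroup H] [InnerProductSpace ℂ H]
    [CompleteSpace H] {ψ : H} (hψ : ‖ψ‖ = 1) : IsDensityOperator (pureState ψ) where
  isPositive := InnerProductSpace.isPositive_rankOne_self ψ
  trace_eq_one ι e := by
    have h := e.hasSum_inner_mul_inner ψ ψ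
    rw [inner_self_eq_norm_sq_to_K, hψ] at h
    simp only [pureState, InnerProductSpace.rankOne_apply, inner_smul_right]
    simpa using h

/-- The linear map `L` with `xᵀ A x = ‖L x‖²` for the matrix `A` of the Gaussian state. -/
def gaussLinear : Config ≃ₗ[ℝ] Config where
  toFun x := (x.1 + x.2.1 + x.2.2, x.1 + x.2.1, x.1 + x.2.2)
  invFun y := (y.2.1 + y.2.2 - y.1, y.1 - y.2.2, y.1 - y.2.1)
  map_add' x y := by ext <;> simp <;> ring
  map_smul' c x := by ext <;> simp <;> ring
  left_inv x := by ext <;> simp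
  right_inv y := by ext <;> simp

theorem gaussLinear_apply (x : Config) :
    gaussLinear x = (x.1 + x.2.1 + x.2.2, x.1 + x.2.1, x.1 + x.2.2) := rfl

/-- Coordinates on the configuration space. -/
def configEquiv : Config ≃ₗ[ℝ] (Fin 3 → ℝ) where
  toFun x := ![x.1, x.2.1, x.2.2]
  invFun v := (v 0, v 1, v 2)
  map_add' x y := by ext i; fin_cases i <;> simp
  map_smul' c x := by ext i; fin_cases i <;> simp
  left_inv x := by simp
  right_inv v := by ext i; fin_cases i <;> simp

theorem det_gaussLinear : LinearMap.det (gaussLinear : Config →ₗ[ℝ] Config) = -1 := by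
  rw [← LinearMap.det_toMatrix (Module.Basis.ofEquivFun configEquiv)]
  have : LinearMap.toMatrix (Module.Basis.ofEquivFun configEquiv)
      (Module.Basis.ofEquivFun configEquiv) (gaussLinear : Config →ₗ[ℝ] Config) =
      !![1, 1, 1; 1, 1, 0; 1, 0, 1] := by
    ext i j
    fin_cases i <;> fin_cases j <;>
      simp [LinearMap.toMatrix_apply, configEquiv, gaussLinear_apply]
  rw [this, Matrix.det_fin_three]
  simp

/-- The determinant is -1, of absolute value one; the Gaussian is the vacuum composed with this map
and therefore keeps its norm. -/
theorem measurePreserving_gaussLinear :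
    MeasurePreserving gaussLinear (volume : Measure Config) volume := by
  refine ⟨gaussLinear.toContinuousLinearEquiv.continuous.measurable, ?_⟩
  have h := Measure.map_linearMap_addHaar_eq_smul_addHaar (volume : Measure Config)
    (f := (gaussLinear : Config →ₗ[ℝ] Config)) (by rw [det_gaussLinear]; norm_num)
  rw [det_gaussLinear] at h
  simpa using h

/-- The wave function of the Gaussian state as a Schwartz function. -/
def gaussS : 𝓢(Config, ℂ) :=
  SchwartzMap.compCLMOfContinuousLinearEquiv ℂ gaussLinear.toContinuousLinearEquiv
    (numberState (0, 0, 0))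

theorem gaussS_apply' (x : Config) : gaussS x = numberState (0, 0, 0) (gaussLinear x) := by
  rw [gaussS, SchwartzMap.compCLMOfContinuousLinearEquiv_apply]
  rfl

theorem gaussS_apply (x : Config) : gaussS x = gaussWave x := by
  have hpi : (Real.pi ^ (-(1 / 4) : ℝ)) ^ 3 = Real.pi ^ (-(3 / 4) : ℝ) := by
    rw [← Real.rpow_natCast, ← Real.rpow_mul Real.pi_pos.le]
    norm_num
  rw [gaussS_apply', numberState_zero_apply, gaussWave, hpi, gaussLinear_apply]
  simp only [gaussMatrix, Matrix.mulVec, dotProduct, Fin.sum_univ_three]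
  simp
  left
  congr 1
  ring

theorem norm_toL2_gaussS : ‖toL2 gaussS‖ = 1 := by
  have h : ⟪toL2 gaussS, toL2 gaussS⟫_ℂ = 1 := by
    rw [← inner_numberState_zero, inner_toL2, inner_toL2]
    simp only [gaussS_apply']
    exact measurePreserving_gaussLinear.integral_comp
      (gaussLinear.toContinuousLinearEquiv.toHomeomorph.measurableEmbedding)
      (fun x => (starRingEnd ℂ) (numberState (0, 0, 0) x) * numberState (0, 0, 0) x)
  rw [norm_eq_sqrt_re_inner (𝕜 := ℂ), h]
  simp

theorem hasDerivAt_exp_quadratic (N a b c : ℝ) :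
    HasDerivAt (fun t : ℝ => ((N * Real.exp (a + b * t + c * t ^ 2) : ℝ) : ℂ))
      ((b * (N * Real.exp a) : ℝ) : ℂ) 0 := by
  have h : HasDerivAt (fun t : ℝ => a + b * t + c * t ^ 2) b 0 := by
    have h1 := (((hasDerivAt_id (0 : ℝ)).const_mul b).const_add a).add
      ((hasDerivAt_pow 2 (0 : ℝ)).const_mul c)
    refine (h1.congr_deriv ?_)
    simp
  refine (h.exp.const_mul N).ofReal_comp.congr_deriv ?_
  simp
  ring

theorem partialDeriv_gaussS (j : Fin 3) (x : Config) : partialDeriv j gaussS x =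
    ((-(((x.1 + x.2.1 + x.2.2) * (gaussLinear (dir j)).1 +
      (x.1 + x.2.1) * (gaussLinear (dir j)).2.1 +
        (x.1 + x.2.2) * (gaussLinear (dir j)).2.2) : ℝ) : ℝ) : ℂ) * gaussS x := by
  rw [partialDeriv_apply]
  refine HasLineDerivAt.lineDeriv ?_
  set y := gaussLinear x with hy
  set d := gaussLinear (dir j) with hd
  have h := hasDerivAt_exp_quadratic ((Real.pi ^ (-(1 / 4) : ℝ)) ^ 3)
    (-((y.1 ^ 2 + y.2.1 ^ 2 + y.2.2 ^ 2) / 2)) (-(y.1 * d.1 + y.2.1 * d.2.1 + y.2.2 * d.2.2))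
    (-((d.1 ^ 2 + d.2.1 ^ 2 + d.2.2 ^ 2) / 2))
  unfold HasLineDerivAt
  refine (h.congr_deriv ?_).congr_of_eventuallyEq (Filter.Eventually.of_forall fun t => ?_)
  · rw [gaussS_apply', numberState_zero_apply, ← Complex.ofReal_mul]
    rfl
  · beta_reduce
    rw [gaussS_apply', numberState_zero_apply, map_add, map_smul, ← hy, ← hd]
    congr 3
    simp
    ring

theorem W_gaussS : W gaussS = 0 := by
  ext x
  simp only [W, creation, annihilation, LinearMap.add_apply, LinearMap.sub_apply,
    LinearMap.smul_apply, add_apply, smul_apply, sub_apply, position_apply, partialDeriv_gaussS]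
  simp [coord, dir, gaussLinear_apply]
  ring

theorem commutator_mode (f : 𝓢(Config, ℂ)) (j k : Fin 3) (x : Config) :
    partialDeriv j (position k f) x =
      (coord k (dir j) : ℂ) * f x + (coord k x : ℂ) * partialDeriv j f x := by
  rw [partialDeriv_apply, partialDeriv_apply]
  refine HasLineDerivAt.lineDeriv ?_
  have h1 : HasLineDerivAt ℝ f (lineDeriv ℝ f x (dir j)) x (dir j) :=
    (f.differentiableAt.lineDifferentiableAt).hasLineDerivAt
  have h2 : HasDerivAt (fun t : ℝ => ((coord k (x + t • dir j) : ℝ) : ℂ))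
      ((coord k (dir j) : ℝ) : ℂ) 0 := by
    refine HasDerivAt.ofReal_comp ?_
    simp only [map_add, map_smul, smul_eq_mul]
    simpa using ((hasDerivAt_id (0 : ℝ)).mul_const (coord k (dir j))).const_add (coord k x)
  have h := h2.mul h1
  unfold HasLineDerivAt
  refine (h.congr_deriv ?_).congr_of_eventuallyEq (Filter.Eventually.of_forall fun t => ?_)
  · simp
  · simp [position_apply]

theorem partialDeriv_mul_position (j k : Fin 3) :
    partialDeriv j * position k =
      position k * partialDeriv j + algebraMap ℂ _ ((coord k (dir j) : ℝ) : ℂ) := by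
  ext f x
  simp only [Module.End.mul_apply, LinearMap.add_apply, add_apply, Module.algebraMap_end_apply,
    smul_apply, smul_eq_mul, commutator_mode, position_apply]
  ring

/-- The sum of the position operators. -/
def positionSum : Module.End ℂ 𝓢(Config, ℂ) := position 0 + position 1 + position 2

/-- The derivative in the direction `(-1, 1, 1)`. -/
def derivSum : Module.End ℂ 𝓢(Config, ℂ) := -partialDeriv 0 + partialDeriv 1 + partialDeriv 2

theorem W_eq : W = ((1 / √2 : ℝ) : ℂ) • (positionSum + derivSum) := by
  simp only [W, creation, annihilation, positionSum, derivSum]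
  module

theorem Wdag_eq : Wdag = ((1 / √2 : ℝ) : ℂ) • (positionSum - derivSum) := by
  simp only [Wdag, creation, annihilation, positionSum, derivSum]
  module

theorem derivSum_mul_positionSum : derivSum * positionSum = positionSum * derivSum + 1 := by
  simp only [derivSum, positionSum, add_mul, mul_add, neg_mul, mul_neg, partialDeriv_mul_position,
    Algebra.algebraMap_eq_smul_one]
  simp only [coord, dir]
  simp
  abel

theorem W_mul_Wdag : W * Wdag = Wdag * W + algebraMap ℂ _ 1 := by
  rw [W_eq, Wdag_eq, smul_mul_smul_comm, smul_mul_smul_comm, inv_sqrt_two_mul_self, map_one]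
  simp only [add_mul, mul_add, sub_mul, mul_sub, derivSum_mul_positionSum]
  module

/-- As W annihilates the Gaussian, pushing one W through W†^(m+1) leaves (m + 1) W†^m, and the
factors accumulate to the factorial. -/
theorem W_pow_Wdag_pow_gaussS (m : ℕ) :
    (W ^ m * Wdag ^ m) gaussS = (m.factorial : ℂ) • gaussS := by
  induction m with
  | zero => simp
  | succ m ih =>
    rw [pow_succ W, mul_assoc, mul_pow_of_commutator W_mul_Wdag, Module.End.mul_apply,
      LinearMap.add_apply, Module.End.mul_apply, W_gaussS, map_zero, zero_add, LinearMap.smul_apply,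
      map_smul, Nat.add_sub_cancel, ← Module.End.mul_apply, ih, smul_smul, Nat.factorial_succ]
    push_cast
    rw [mul_one]

theorem expect_gaussS (m : ℕ) :
    expectMulAdjoint (W ^ m) (pureState (toL2 gaussS)) = (m.factorial : ℝ≥0∞) := by
  rw [expect_pure, W_pow_Wdag_pow_gaussS, toL2_smul, inner_smul_right, inner_self_eq_norm_sq_to_K,
    norm_toL2_gaussS]
  simp

end ThreeMode

end

open ThreeMode in
theorem mainTheorem2 :
    (∀ (m : ℕ) (ρ : L2 Config →L[ℂ] L2 Config), IsDensityOperator ρ → IsSeparable1_23 ρ →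
      (2 : ℝ≥0∞) ^ m ≤ A1_23 m ρ) ∧
    (∀ (m : ℕ) (ρ : L2 Config →L[ℂ] L2 Config), IsDensityOperator ρ → 1 ≤ A1_23 m ρ) ∧
    (∃ ψ : L2 Config, ψ =ᵐ[volume] gaussWave ∧ IsDensityOperator (pureState ψ) ∧
      ∀ m : ℕ, 1 ≤ m → A1_23 m (pureState ψ) = 1 ∧
        ∀ ρ : L2 Config →L[ℂ] L2 Config, IsDensityOperator ρ →
          A1_23 m (pureState ψ) ≤ A1_23 m ρ) := by
  have hg : ∀ m : ℕ, A1_23 m (pureState (toL2 gaussS)) = 1 := fun m => by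
    rw [A1_23, expect_gaussS]
    exact ENNReal.div_self (by exact_mod_cast m.factorial_ne_zero) (ENNReal.natCast_ne_top _)
  have hone : ∀ (m : ℕ) (ρ : L2 Config →L[ℂ] L2 Config), IsDensityOperator ρ → 1 ≤ A1_23 m ρ := by
    intro m ρ hρ
    rw [A1_23, ENNReal.le_div_iff_mul_le (Or.inl (by exact_mod_cast m.factorial_ne_zero))
      (Or.inl (ENNReal.natCast_ne_top _)), one_mul]
    exact factorial_le_expect hρ m
  refine ⟨fun m ρ hρ hsep => ?_, hone, toL2 gaussS, ?_,
    isDensityOperator_pureState norm_toL2_gaussS, fun m _ => ⟨hg m, fun ρ hρ => ?_⟩⟩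
  · rw [A1_23, ENNReal.le_div_iff_mul_le (Or.inl (by exact_mod_cast m.factorial_ne_zero))
      (Or.inl (ENNReal.natCast_ne_top _)), mul_comm]
    exact factorial_mul_two_pow_le_expect hρ hsep m
  · filter_upwards [SchwartzMap.coeFn_toLp gaussS 2 (volume : Measure Config)] with x hx
    rw [toL2, hx, gaussS_apply]
  · rw [hg]
    exact hone m ρ hρ
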